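/- Let $Q(x,y,z)$ be a positive definite real quadratic form and let $d\ge 1$. Write $\mathbb{R}^{3\circ}=\mathbb{R}^3\setminus\{0\}$ for the space of nonzero real linear forms $L=ax+by+cz$ (identified with their coefficient vectors). Define the following spaces, each with the quotient topology. * The real multipole space $\mathcal{M}^{\mathbb{R}}(d)=(\mathbb{R}^{3\circ})^d/\Sigma_d^{\mathbb{R}}$, where $\Sigma_d^{\mathbb{R}}$ is the group generated by the permutations of the $d$ factors and the rescalings $(L_j)\mapsto(c_jL_j)$ with $c_j\in\mathbb{R}^*$, $\prod_j c_j=1$. * The symmetric power $\mathrm{Sym}^d(\mathbb{R}P^2)=(\mathbb{R}P^2)^d/S_d$, where $\mathbb{R}P^2=\mathbb{R}^{3\circ}/\mathbb{R}^*$. The group $\mathbb{R}^*$ acts on $\mathcal{M}^{\mathbb{R}}(d)$ by multiplying one of the forms, and $\mathcal{M}^{\mathbb{R}}(d)/\mathbb{R}^*=\mathrm{Sym}^d(\mathbb{R}P^2)$. * The coned multipole space $\overline{\mathcal{M}}^{\mathbb{R}}(d)$, obtained from the line bundle $\mathcal{M}^{\mathbb{R}}(d)\times_{\mathbb{R}^*}\mathbb{R}\to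 \mathrm{Sym}^d(\mathbb{R}P^2)$ by collapsing its zero section to a point. The smooth structures are as follows. For a $Q$-orthonormal basis $v=(v_0,v_1,v_2)$ of $\mathbb{R}^3$ let $\alpha(u)=(u^2-1)v_0-\mathrm{i}(u^2+1)v_1+2uv_2$, $u\in\mathbb{C}$, which parametrizes the complex conic $\{Q=0\}$. A real linear form $L$ with $L(v_2)\ne 0$ satisfies $L(\alpha(u))=\nu\,(u-w)(1+\bar w u)$ for unique $\nu=\nu_v(L)\in\mathbb{R}^*$ and $w=w_v(L)\in\mathbb{C}$ with $|w|<1$, and $w_v$ is a local complex coordinate on $\mathbb{R}P^2$. The charts of $\mathrm{Sym}^d(\mathbb{R}P^2)$ are, for all such $v$, the maps sending $[L_1,\dots,L_d]$ with all $L_j(v_2)\neq 0$ to the non-leading coefficients, in $\mathbb{C}^d$, of $\prod_j (X-w_v(L_j))$; the charts of $\mathcal{M}^{\mathbb{R}}(d)$ are given by these coefficients together with $\prod_j\nu_v(L_j)\in\mathbb{R}$. The space $\mathbb{R}P^{2d}$ carries its standard affine charts. Then these charts make $\mathcal{M}^{\mathbb{R}}(d)$ and $\mathrm{Sym}^d(\mathbb{R}P^2)$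 smooth manifolds, and 1. $\mathcal{M}^{\mathbb{R}}(d)$ is diffeomorphic to $\mathbb{R}^{2d+1}\setminus\{0\}$, and hence to $S^{2d}\times\mathbb{R}$; 2. $\overline{\mathcal{M}}^{\mathbb{R}}(d)$ is homeomorphic to $\mathbb{R}^{2d+1}$; 3. $\mathrm{Sym}^d(\mathbb{R}P^2)$ is diffeomorphic to $\mathbb{R}P^{2d}$. -/

import Mathlib

open scoped Manifold ContDiff LinearAlgebra.Projectivization

noncomputable section

/-! ### Projective spaces -/

/-- The quotient topology on the projectivization of a real topological vector space. -/
instance Projectivization.instTopologicalSpaceReal (V : Type*) [AddCommGroup V] [Module ℝ V]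
    [TopologicalSpace V] : TopologicalSpace (ℙ ℝ V) :=
  inferInstanceAs (TopologicalSpace (Quotient (projectivizationSetoid ℝ V)))

/-- Real projective space `ℝPⁿ`, the space of lines through the origin in `ℝⁿ⁺¹`. -/
abbrev RealProj (n : ℕ) : Type := ℙ ℝ (Fin (n + 1) → ℝ)

namespace RealProj

/-- The set of points `[x₀ : … : xₙ]` with `xᵢ ≠ 0`. -/
def affineDomain {n : ℕ} (i : Fin (n + 1)) : Set (RealProj n) :=
  {p | p.rep i ≠ 0}

/-- The affine coordinates `[x₀ : … : xₙ] ↦ (xⱼ / xᵢ)` with `j ≠ i`. -/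
def affineCoord {n : ℕ} (i : Fin (n + 1)) : RealProj n → (Fin n → ℝ) :=
  Projectivization.lift (fun x j => x.1 (i.succAbove j) / x.1 i) (by
    rintro ⟨a, ha⟩ ⟨b, hb⟩ t rfl
    have ht : t ≠ 0 := by
      rintro rfl
      simp at ha
    funext j
    simp [mul_div_mul_left _ _ ht])

/-- The standard atlas of `ℝPⁿ`: the affine charts. -/
def stdAtlas (n : ℕ) : Set (OpenPartialHomeomorph (RealProj n) (Fin n → ℝ)) :=
  {φ | ∃ i : Fin (n + 1), φ.source = affineDomain i ∧ Set.EqOn φ (affineCoord i) φ.source}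

end RealProj

/-! ### Symmetric powers and multipole spaces as topological spaces -/

/-- Two `d`-tuples are equivalent when they differ by a permutation. -/
def symPowerSetoid (X : Type*) (d : ℕ) : Setoid (Fin d → X) where
  r x y := ∃ σ : Equiv.Perm (Fin d), y = x ∘ σ
  iseqv :=
    { refl := fun x => ⟨1, rfl⟩
      symm := by
        rintro x y ⟨σ, rfl⟩
        exact ⟨σ⁻¹, by funext i; simp⟩
      trans := by
        rintro x y z ⟨σ, rfl⟩ ⟨τ, rfl⟩
        exact ⟨σ * τ, rfl⟩ }

/-- The symmetric power `Symᵈ(X) = Xᵈ / S_d`. -/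
def SymPower (X : Type*) (d : ℕ) : Type _ := Quotient (symPowerSetoid X d)

instance SymPower.instTopologicalSpace (X : Type*) [TopologicalSpace X] (d : ℕ) :
    TopologicalSpace (SymPower X d) :=
  inferInstanceAs (TopologicalSpace (Quotient (symPowerSetoid X d)))

/-- A nonzero linear form `a x + b y + c z`, given by its vector of coefficients. -/
abbrev LinForm : Type := {L : Fin 3 → ℝ // L ≠ 0}

/-- Multiplication of a nonzero linear form by a nonzero scalar. -/
def LinForm.scale (t : ℝˣ) (L : LinForm) : LinForm :=
  ⟨(t : ℝ) • L.1, smul_ne_zero t.ne_zero L.2⟩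

theorem LinForm.scale_one (L : LinForm) : LinForm.scale 1 L = L := by
  apply Subtype.ext
  simp [LinForm.scale]

theorem LinForm.scale_scale (s t : ℝˣ) (L : LinForm) :
    LinForm.scale s (LinForm.scale t L) = LinForm.scale (s * t) L := by
  apply Subtype.ext
  simp [LinForm.scale, mul_smul]

/-- The orbit relation on `d`-tuples of nonzero linear forms of the group generated by the
permutations of the factors and the rescalings `(L_j) ↦ (c_j L_j)` with `∏ c_j = 1`. -/
def multipoleSetoid (d : ℕ) : Setoid (Fin d → LinForm) where
  r L M := ∃ (σ : Equiv.Perm (Fin d)) (c : Fin d → ℝˣ), ∏ j, c j = 1 ∧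
    ∀ j, M j = LinForm.scale (c j) (L (σ j))
  iseqv :=
    { refl := fun L => ⟨1, 1, by simp, fun j => (LinForm.scale_one _).symm⟩
      symm := by
        rintro L M ⟨σ, c, hc, h⟩
        refine ⟨σ⁻¹, fun j => (c (σ⁻¹ j))⁻¹, ?_, fun j => ?_⟩
        · rw [Equiv.prod_comp σ⁻¹ fun j => (c j)⁻¹, Finset.prod_inv_distrib, hc, inv_one]
        · rw [h, LinForm.scale_scale, inv_mul_cancel, LinForm.scale_one]
          simp
      trans := by
        rintro L M N ⟨σ, c, hc, h⟩ ⟨τ, b, hb, k⟩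
        refine ⟨σ * τ, fun j => b j * c (τ j), ?_, fun j => ?_⟩
        · rw [Finset.prod_mul_distrib, hb, Equiv.prod_comp τ c, hc, one_mul]
        · rw [k, h, LinForm.scale_scale]
          rfl }

/-- The real multipole space: unordered `d`-tuples of nonzero linear forms, up to rescalings
of the forms with product one. -/
def MultipoleSpace (d : ℕ) : Type := Quotient (multipoleSetoid d)

instance MultipoleSpace.instTopologicalSpace (d : ℕ) : TopologicalSpace (MultipoleSpace d) :=
  inferInstanceAs (TopologicalSpace (Quotient (multipoleSetoid d)))

/-- The multipole represented by a tuple of nonzero linear forms. -/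
def MultipoleSpace.mk {d : ℕ} (L : Fin d → LinForm) : MultipoleSpace d :=
  Quotient.mk (multipoleSetoid d) L

/-- The identifications `(t · m, s) ∼ (m, t s)`, for `t ∈ ℝ^*`, on pairs of a multipole and a
real number. Here `t` multiplies a multipole by rescaling its forms by any nonzero numbers whose
product is `t`. -/
def multipoleLineSetoid (d : ℕ) : Setoid (MultipoleSpace d × ℝ) where
  r p q := ∃ (L : Fin d → LinForm) (c : Fin d → ℝˣ), p.1 = MultipoleSpace.mk L ∧
    q.1 = MultipoleSpace.mk (fun j => LinForm.scale (c j) (L j)) ∧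
    p.2 = ((∏ j, c j : ℝˣ) : ℝ) * q.2
  iseqv :=
    { refl := by
        rintro ⟨m, s⟩
        induction m using Quotient.inductionOn with
        | h L => exact ⟨L, 1, rfl, by simp [LinForm.scale_one]; rfl, by simp⟩
      symm := by
        rintro ⟨m, s⟩ ⟨n, t⟩ ⟨L, c, hm, hn, hs⟩
        refine ⟨fun j => LinForm.scale (c j) (L j), c⁻¹, hn, ?_, ?_⟩
        · simpa [LinForm.scale_scale, LinForm.scale_one] using hm
        · simp only at hs
          rw [hs, ← mul_assoc, ← Units.val_mul, ← Finset.prod_mul_distrib]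
          simp
      trans := by
        rintro ⟨m, s⟩ ⟨n, t⟩ ⟨o, u⟩ ⟨L, c, hm, hn, hs⟩ ⟨M, b, hn', ho, ht⟩
        obtain ⟨σ, a, ha, h⟩ : (multipoleSetoid d).r (fun j => LinForm.scale (c j) (L j)) M :=
          Quotient.exact (hn.symm.trans hn')
        simp only at hm hn ho hs ht
        refine ⟨L, fun j => b (σ⁻¹ j) * c j, hm, ?_, ?_⟩
        · rw [ho]
          refine Quotient.sound ?_
          change (multipoleSetoid d).r _ _
          refine ⟨σ⁻¹, fun j => (a (σ⁻¹ j))⁻¹, ?_, fun j => ?_⟩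
          · rw [Equiv.prod_comp σ⁻¹ fun j => (a j)⁻¹, Finset.prod_inv_distrib, ha, inv_one]
          · simp only [h, LinForm.scale_scale]
            rw [show σ (σ⁻¹ j) = j by simp]
            congr 1
            rw [mul_comm (b (σ⁻¹ j)) (a (σ⁻¹ j) * c j), ← mul_assoc, ← mul_assoc,
              inv_mul_cancel, one_mul, mul_comm]
        · rw [hs, ht, Finset.prod_mul_distrib, Equiv.prod_comp σ⁻¹ b, ← mul_assoc]
          push_cast
          ring }

/-- The total space `M ×_{ℝ^*} ℝ` of the line bundle over the symmetric power of `ℝP²` that is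
associated with the principal `ℝ^*`-bundle given by the multipole space `M`. -/
def MultipoleLineBundle (d : ℕ) : Type := Quotient (multipoleLineSetoid d)

instance MultipoleLineBundle.instTopologicalSpace (d : ℕ) :
    TopologicalSpace (MultipoleLineBundle d) :=
  inferInstanceAs (TopologicalSpace (Quotient (multipoleLineSetoid d)))

/-- The zero section of the line bundle. -/
def MultipoleLineBundle.zeroSection (d : ℕ) : Set (MultipoleLineBundle d) :=
  {x | ∃ m : MultipoleSpace d, x = Quotient.mk (multipoleLineSetoid d) (m, 0)}

/-- Two points of the line bundle are equivalent if they are equal or both on the zero section. -/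
def conedSetoid (d : ℕ) : Setoid (MultipoleLineBundle d) where
  r x y := x = y ∨
    (x ∈ MultipoleLineBundle.zeroSection d ∧ y ∈ MultipoleLineBundle.zeroSection d)
  iseqv :=
    { refl := fun x => Or.inl rfl
      symm := by
        rintro x y (h | ⟨h, k⟩)
        · exact Or.inl h.symm
        · exact Or.inr ⟨k, h⟩
      trans := by
        rintro x y z (rfl | ⟨h, k⟩) (rfl | ⟨h', k'⟩)
        · exact Or.inl rfl
        · exact Or.inr ⟨h', k'⟩
        · exact Or.inr ⟨h, k⟩
        · exact Or.inr ⟨h, k'⟩ }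

/-- The coned multipole space: the line bundle with its zero section collapsed to a point. -/
def ConedMultipoleSpace (d : ℕ) : Type := Quotient (conedSetoid d)

instance ConedMultipoleSpace.instTopologicalSpace (d : ℕ) :
    TopologicalSpace (ConedMultipoleSpace d) :=
  inferInstanceAs (TopologicalSpace (Quotient (conedSetoid d)))

/-! ### Smooth structures

For a positive definite form `Q`, a point of `ℝP²`, that is, a linear form `L` up to scaling, is a
pair of complex conjugate points of the complex conic `Q = 0`, which is a Riemann sphere. So `ℝP²`
has local complex coordinates, well defined up to holomorphic and antiholomorphic changes of
coordinates, and the coefficients of `∏ (X - w_j)` are smooth coordinates on the symmetric power.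

Explicitly, let `v` be a `Q`-orthonormal basis of the `(x, y, z)`-space. The conic is
parametrized by `α(u) = (u² - 1) v₀ - i (u² + 1) v₁ + 2 u v₂`, and a linear form `L` with
`L(v₂) ≠ 0` satisfies `L(α(u)) = ν (u - w) (1 + w̄ u)`, where the real number `ν ≠ 0` and the complex
number `w` of modulus less than one are the ones defined below. -/

/-- `v` is an orthonormal basis for `Q`. -/
def IsOrthonormalFrame (Q : QuadraticForm ℝ (Fin 3 → ℝ)) (v : Fin 3 → (Fin 3 → ℝ)) : Prop :=
  (∀ i, Q (v i) = 1) ∧ ∀ i j, i ≠ j → QuadraticMap.IsOrtho Q (v i) (v j)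

/-- The value of the linear form with coefficients `L` on the `i`-th vector of the frame. -/
def frameValue (v : Fin 3 → (Fin 3 → ℝ)) (i : Fin 3) (L : Fin 3 → ℝ) : ℝ := L ⬝ᵥ v i

/-- The scalar coordinate `ν = ℓ₂ + sgn(ℓ₂) |ℓ|` of a linear form with values `ℓ` on the frame. -/
def conicScale (v : Fin 3 → (Fin 3 → ℝ)) (L : Fin 3 → ℝ) : ℝ :=
  frameValue v 2 L + Real.sign (frameValue v 2 L) *
    Real.sqrt (frameValue v 0 L ^ 2 + frameValue v 1 L ^ 2 + frameValue v 2 L ^ 2)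

/-- The complex coordinate `w = (ℓ₀ + i ℓ₁) / ν` of a linear form with values `ℓ` on the frame. -/
def conicCoord (v : Fin 3 → (Fin 3 → ℝ)) (L : Fin 3 → ℝ) : ℂ :=
  ((frameValue v 0 L : ℂ) + Complex.I * (frameValue v 1 L : ℂ)) / (conicScale v L : ℂ)

theorem frameValue_smul (v : Fin 3 → (Fin 3 → ℝ)) (i : Fin 3) (t : ℝ) (L : Fin 3 → ℝ) :
    frameValue v i (t • L) = t * frameValue v i L := by
  simp [frameValue]

theorem conicScale_smul (v : Fin 3 → (Fin 3 → ℝ)) {t : ℝ} (ht : t ≠ 0) (L : Fin 3 → ℝ) :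
    conicScale v (t • L) = t * conicScale v L := by
  have hs : Real.sqrt ((t * frameValue v 0 L) ^ 2 + (t * frameValue v 1 L) ^ 2 +
      (t * frameValue v 2 L) ^ 2) = |t| *
      Real.sqrt (frameValue v 0 L ^ 2 + frameValue v 1 L ^ 2 + frameValue v 2 L ^ 2) := by
    rw [← Real.sqrt_sq_eq_abs, ← Real.sqrt_mul (sq_nonneg t)]
    congr 1
    ring
  have hsign : Real.sign (t * frameValue v 2 L) * |t| = t * Real.sign (frameValue v 2 L) := by
    have h : Real.sign (t * frameValue v 2 L) = Real.sign t * Real.sign (frameValue v 2 L) := by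
      rcases lt_trichotomy t 0 with h1 | h1 | h1 <;>
      rcases lt_trichotomy (frameValue v 2 L) 0 with h2 | h2 | h2 <;>
      simp [h1, h2, Real.sign_of_neg, Real.sign_of_pos, mul_pos_of_neg_of_neg,
        mul_neg_of_neg_of_pos, mul_neg_of_pos_of_neg]
    rw [h, mul_right_comm]
    congr 1
    rcases lt_or_gt_of_ne ht with h1 | h1
    · simp [Real.sign_of_neg h1, abs_of_neg h1]
    · simp [Real.sign_of_pos h1, abs_of_pos h1]
  simp only [conicScale, frameValue_smul]
  rw [hs, ← mul_assoc, hsign]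
  ring

theorem conicCoord_smul (v : Fin 3 → (Fin 3 → ℝ)) {t : ℝ} (ht : t ≠ 0) (L : Fin 3 → ℝ) :
    conicCoord v (t • L) = conicCoord v L := by
  have ht' : (t : ℂ) ≠ 0 := by exact_mod_cast ht
  simp only [conicCoord, frameValue_smul, conicScale_smul v ht]
  push_cast
  rw [← mul_div_mul_left ((frameValue v 0 L : ℂ) + Complex.I * (frameValue v 1 L : ℂ)) _ ht']
  congr 1
  ring

/-- The complex coordinate as a function on `ℝP²`. -/
def projConicCoord (v : Fin 3 → (Fin 3 → ℝ)) : RealProj 2 → ℂ :=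
  Projectivization.lift (fun L => conicCoord v L.1) (by
    rintro ⟨a, ha⟩ ⟨b, hb⟩ t rfl
    have ht : t ≠ 0 := by
      rintro rfl
      simp at ha
    exact conicCoord_smul v ht b)

/-- The coefficients of `1, X, …, X^{d-1}` in the monic polynomial with roots `w`; up to sign they
are the elementary symmetric functions of `w`. -/
def rootCoeffs {d : ℕ} (w : Fin d → ℂ) : Fin d → ℂ :=
  fun k => (∏ j, (Polynomial.X - Polynomial.C (w j))).coeff k

theorem rootCoeffs_comp {d : ℕ} (w : Fin d → ℂ) (σ : Equiv.Perm (Fin d)) :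
    rootCoeffs (w ∘ σ) = rootCoeffs w := by
  funext k
  simp only [rootCoeffs, Function.comp_apply]
  rw [Equiv.prod_comp σ fun j => Polynomial.X - Polynomial.C (w j)]

namespace SymPower

/-- The unordered `d`-tuples of points of `ℝP²` that avoid the line `L(v₂) = 0`. -/
def chartDomain (v : Fin 3 → (Fin 3 → ℝ)) (d : ℕ) : Set (SymPower (RealProj 2) d) :=
  {x | ∃ p : Fin d → RealProj 2, x = Quotient.mk (symPowerSetoid _ d) p ∧
    ∀ j, frameValue v 2 (p j).rep ≠ 0}

/-- The elementary symmetric functions of the complex coordinates of `d` points of `ℝP²`. -/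
def chartCoord (v : Fin 3 → (Fin 3 → ℝ)) (d : ℕ) : SymPower (RealProj 2) d → (Fin d → ℂ) :=
  Quotient.lift (fun p => rootCoeffs fun j => projConicCoord v (p j)) (by
    rintro p q ⟨σ, rfl⟩
    exact (rootCoeffs_comp (fun j => projConicCoord v (p j)) σ).symm)

/-- The atlas of the symmetric power of `ℝP²` defined by a positive definite form. -/
def conicAtlas (Q : QuadraticForm ℝ (Fin 3 → ℝ)) (d : ℕ) :
    Set (OpenPartialHomeomorph (SymPower (RealProj 2) d) (Fin d → ℂ)) :=
  {φ | ∃ v, IsOrthonormalFrame Q v ∧ φ.source = chartDomain v d ∧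
    Set.EqOn φ (chartCoord v d) φ.source}

end SymPower

namespace MultipoleSpace

/-- The multipoles all of whose linear forms satisfy `L(v₂) ≠ 0`. -/
def chartDomain (v : Fin 3 → (Fin 3 → ℝ)) (d : ℕ) : Set (MultipoleSpace d) :=
  {m | ∃ L : Fin d → LinForm, m = mk L ∧ ∀ j, frameValue v 2 (L j).1 ≠ 0}

/-- The elementary symmetric functions of the complex coordinates of the forms of a multipole,
together with the product of their scalar coordinates (the coordinate along the fibre of the
bundle over the symmetric power of `ℝP²`). -/
def chartCoord (v : Fin 3 → (Fin 3 → ℝ)) (d : ℕ) : MultipoleSpace d → (Fin d → ℂ) × ℝ :=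
  Quotient.lift
    (fun L => (rootCoeffs fun j => conicCoord v (L j).1, ∏ j, conicScale v (L j).1)) (by
    rintro L M ⟨σ, c, hc, h⟩
    have hw : (fun j => conicCoord v (M j).1) = (fun j => conicCoord v (L j).1) ∘ σ := by
      funext j
      rw [h]
      exact conicCoord_smul v (c j).ne_zero _
    have hn : ∏ j, conicScale v (M j).1 = ∏ j, conicScale v (L j).1 := by
      have h1 : ∀ j, conicScale v (M j).1 = (c j : ℝ) * conicScale v (L (σ j)).1 := fun j => by
        rw [h]
        exact conicScale_smul v (c j).ne_zero _
      have hc' : ∏ j, (c j : ℝ) = 1 := by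
        rw [← Units.coe_prod, hc, Units.val_one]
      simp only [h1]
      rw [Finset.prod_mul_distrib, hc', one_mul,
        Equiv.prod_comp σ fun j => conicScale v (L j).1]
    simp only [hw, hn, rootCoeffs_comp])

/-- The atlas of the multipole space defined by a positive definite form. -/
def conicAtlas (Q : QuadraticForm ℝ (Fin 3 → ℝ)) (d : ℕ) :
    Set (OpenPartialHomeomorph (MultipoleSpace d) ((Fin d → ℂ) × ℝ)) :=
  {φ | ∃ v, IsOrthonormalFrame Q v ∧ φ.source = chartDomain v d ∧
    Set.EqOn φ (chartCoord v d) φ.source}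

end MultipoleSpace

/-- The vector space `ℝⁿ` with the origin removed, as an open submanifold. -/
def puncturedSpace (n : ℕ) : TopologicalSpace.Opens (EuclideanSpace ℝ (Fin n)) :=
  ⟨{0}ᶜ, isOpen_compl_singleton⟩

end

/-!
In an orthonormal frame, `L ↦ L(α(u))` identifies the real linear forms with the complex quadratic
polynomials `p` satisfying `p(u) = -u² conj (p(-1 / conj u))`, and the roots of `L(α(u))` form an
antipodal pair `w, -1 / conj w`. Hence `∏ⱼ Lⱼ(α(u))` lies in the real vector space of dimension
`2d + 1` formed by the polynomials of degree at most `2d` with the corresponding `(-1)ᵈ`-twisted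
symmetry. By the fundamental theorem of algebra and the pairing of the roots, every nonzero element
of that space is such a product, and its roots determine the factors up to permutation and
rescaling. So the product induces a continuous bijection from the multipole space to the nonzero
vectors. It is a homeomorphism: after normalizing the forms to unit norm, a multipole is a point of
a compact space together with a scalar, and scaling a compact set of nonzero vectors is proper.

Changing the frame acts on the target by a linear map, so smoothness needs to be checked in a single
frame only. There the inverse of a chart is
`(∏ⱼ (u - wⱼ), t) ↦ t ∏ⱼ (u - wⱼ)(1 + conj wⱼ u)`, whose derivative is invertible since the two
factors are coprime when all `wⱼ` lie in the open unit disc. The statements about the coned space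
and the symmetric power follow by extending the homeomorphism by zero and by dividing by `ℝ^*`.
-/

noncomputable section

open Polynomial ComplexConjugate

/-! ### The antipodal duality of polynomials -/

section AntipodalDual

variable {R : Type*} [CommRing R]

theorem coeff_neg_one_pow_mul (n k : ℕ) (P : R[X]) :
    ((-1) ^ n * P).coeff k = (-1) ^ n * P.coeff k := by
  rcases n.even_or_odd with h | h <;> simp [h.neg_one_pow]

theorem coeff_comp_neg_X (P : R[X]) (k : ℕ) : (P.comp (-X)).coeff k = (-1) ^ k * P.coeff k := by
  rw [show (-X : R[X]) = C (-1) * X by simp, comp_C_mul_X_coeff, mul_comm]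

variable [StarRing R]

/-- The polynomial `(-X)ᴺ · conj P(-1 / conj X)`, for `P` of degree at most `N`. This is how the
antipodal map of the Riemann sphere acts on binary forms of degree `N`. -/
def antipodalDual (N : ℕ) : R[X] →ₛₗ[starRingEnd R] R[X] where
  toFun P := (-1) ^ N * reflect N ((P.map (starRingEnd R)).comp (-X))
  map_add' P S := by simp [reflect_add, mul_add]
  map_smul' t P := by
    simp only [smul_eq_C_mul, Polynomial.map_mul, map_C, mul_comp, C_comp, reflect_C_mul]
    ring

theorem antipodalDual_apply (N : ℕ) (P : R[X]) :
    antipodalDual N P = (-1) ^ N * reflect N ((P.map (starRingEnd R)).comp (-X)) :=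
  rfl

theorem coeff_antipodalDual {N k : ℕ} (hk : k ≤ N) (P : R[X]) :
    (antipodalDual N P).coeff k = (-1) ^ k * conj (P.coeff (N - k)) := by
  obtain ⟨m, rfl⟩ := Nat.exists_eq_add_of_le hk
  rw [antipodalDual_apply, coeff_neg_one_pow_mul, coeff_reflect, revAt_le hk, coeff_comp_neg_X,
    coeff_map, ← mul_assoc, ← pow_add, Nat.add_sub_cancel_left, add_assoc, ← two_mul, pow_add,
    (even_two_mul m).neg_one_pow, mul_one]

theorem natDegree_map_comp_neg_X_le {N : ℕ} {P : R[X]} (hP : P.natDegree ≤ N) :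
    ((P.map (starRingEnd R)).comp (-X)).natDegree ≤ N :=
  natDegree_le_iff_coeff_eq_zero.2 fun k hk => by
    rw [coeff_comp_neg_X, coeff_map, coeff_eq_zero_of_natDegree_lt (hP.trans_lt hk), map_zero,
      mul_zero]

theorem natDegree_antipodalDual_le {N : ℕ} {P : R[X]} (hP : P.natDegree ≤ N) :
    (antipodalDual N P).natDegree ≤ N :=
  natDegree_le_iff_coeff_eq_zero.2 fun k hk => by
    rw [antipodalDual_apply, coeff_neg_one_pow_mul, coeff_eq_zero_of_natDegree_lt, mul_zero]
    exact natDegree_reflect_le.trans_lt (max_lt hk ((natDegree_map_comp_neg_X_le hP).trans_lt hk))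

theorem antipodalDual_mul {M N : ℕ} {P S : R[X]} (hP : P.natDegree ≤ M) (hS : S.natDegree ≤ N) :
    antipodalDual (M + N) (P * S) = antipodalDual M P * antipodalDual N S := by
  simp only [antipodalDual_apply, Polynomial.map_mul, mul_comp]
  rw [reflect_mul _ _ (natDegree_map_comp_neg_X_le hP) (natDegree_map_comp_neg_X_le hS)]
  ring

theorem antipodalDual_zero_one : antipodalDual 0 (1 : R[X]) = 1 := by
  simp [antipodalDual_apply, reflect_one]

theorem antipodalDual_prod {ι : Type*} (s : Finset ι) {n : ι → ℕ} {f : ι → R[X]}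
    (hf : ∀ i ∈ s, (f i).natDegree ≤ n i) :
    antipodalDual (∑ i ∈ s, n i) (∏ i ∈ s, f i) = ∏ i ∈ s, antipodalDual (n i) (f i) := by
  classical
  induction s using Finset.induction_on with
  | empty => simpa using antipodalDual_zero_one
  | insert i s hi ih =>
    rw [Finset.forall_mem_insert] at hf
    rw [Finset.sum_insert hi, Finset.prod_insert hi, Finset.prod_insert hi, ← ih hf.2,
      antipodalDual_mul hf.1 ((natDegree_prod_le s f).trans (Finset.sum_le_sum hf.2))]

theorem antipodalDual_antipodalDual {N : ℕ} {P : R[X]} (hP : P.natDegree ≤ N) :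
    antipodalDual N (antipodalDual N P) = (-1) ^ N * P := by
  ext k
  rw [coeff_neg_one_pow_mul]
  rcases le_or_gt k N with hk | hk
  · rw [coeff_antipodalDual hk, coeff_antipodalDual (Nat.sub_le _ _), Nat.sub_sub_self hk, map_mul,
      map_pow, map_neg, map_one, starRingEnd_self_apply, ← mul_assoc, ← pow_add,
      Nat.add_sub_of_le hk]
  · rw [coeff_eq_zero_of_natDegree_lt (hP.trans_lt hk), mul_zero, coeff_eq_zero_of_natDegree_lt]
    exact (natDegree_antipodalDual_le (natDegree_antipodalDual_le hP)).trans_lt hk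

theorem antipodalDual_X_sub_C (w : R) : antipodalDual 1 (X - C w) = 1 + C (conj w) * X := by
  rw [antipodalDual_apply]
  simp only [pow_one, Polynomial.map_sub, map_X, map_C, sub_comp, X_comp, C_comp, reflect_sub,
    reflect_neg, reflect_one_X, reflect_C, neg_mul, one_mul, neg_sub, sub_neg_eq_add]
  ring

theorem antipodalDual_prod_X_sub_C {d : ℕ} (w : Fin d → R) :
    antipodalDual d (∏ j, (X - C (w j))) = ∏ j, (1 + C (conj (w j)) * X) := by
  simpa [antipodalDual_X_sub_C] using
    antipodalDual_prod Finset.univ fun j _ => natDegree_X_sub_C_le (w j)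

theorem eval_antipodalDual {K : Type*} [Field K] [StarRing K] {N : ℕ} {P : K[X]}
    (hP : P.natDegree ≤ N) {z : K} (hz : z ≠ 0) :
    (antipodalDual N P).eval z = (-z) ^ N * conj (P.eval (-(conj z)⁻¹)) := by
  let := invertibleOfNonzero (inv_ne_zero hz)
  have h := eval₂_reflect_mul_pow (RingHom.id K) z⁻¹ N _ (natDegree_map_comp_neg_X_le hP)
  have hconj : ((P.map (starRingEnd K)).comp (-X)).eval z⁻¹ = conj (P.eval (-(conj z)⁻¹)) := by
    simp [eval_comp, eval_map, ← eval₂_at_apply]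
  simp only [invOf_eq_inv, inv_inv, eval₂_id, hconj] at h
  rw [antipodalDual_apply, ← h]
  simp only [eval_mul, eval_pow, eval_neg, eval_one, inv_pow]
  rw [neg_pow z]
  field_simp

end AntipodalDual

/-! ### Antipodally real polynomials -/

theorem antipodalDual_real_smul (N : ℕ) (t : ℝ) (P : ℂ[X]) :
    antipodalDual N (t • P) = t • antipodalDual N P := by
  rw [← Complex.coe_smul, map_smulₛₗ, Complex.conj_ofReal, Complex.coe_smul]

/-- The real form of the space of complex polynomials of degree at most `2 * d` that is cut out by
the antipodal duality. The sign makes `P · antipodalDual d P` a member for `P` of degree `d`. -/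
def antipodalReal (d : ℕ) : Submodule ℝ ℂ[X] where
  carrier := {P | P.natDegree ≤ 2 * d ∧ antipodalDual (2 * d) P = (-1) ^ d * P}
  zero_mem' := by simp
  add_mem' {P S} hP hS :=
    ⟨natDegree_add_le_of_degree_le hP.1 hS.1, by rw [map_add, hP.2, hS.2, mul_add]⟩
  smul_mem' t P hP :=
    ⟨(natDegree_smul_le t P).trans hP.1, by rw [antipodalDual_real_smul, hP.2, mul_smul_comm]⟩

section AntipodalReal

variable {d e : ℕ} {P S : ℂ[X]}

theorem coeff_eq_of_mem_antipodalReal (hP : P ∈ antipodalReal d) {k : ℕ} (hk : k ≤ 2 * d) :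
    P.coeff k = (-1) ^ (d + k) * conj (P.coeff (2 * d - k)) := by
  have h := congrArg (coeff · k) hP.2
  simp only [coeff_antipodalDual hk, coeff_neg_one_pow_mul] at h
  rw [pow_add, mul_assoc, h, ← mul_assoc, ← pow_add, (Even.add_self d).neg_one_pow, one_mul]

theorem add_antipodalDual_mem_antipodalReal (hP : P.natDegree ≤ 2 * d) :
    P + (-1) ^ d * antipodalDual (2 * d) P ∈ antipodalReal d := by
  have hdual : antipodalDual (2 * d) ((-1) ^ d * antipodalDual (2 * d) P) = (-1) ^ d * P := by
    rcases d.even_or_odd with h | h <;>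
      simp [h.neg_one_pow, antipodalDual_antipodalDual hP]
  refine ⟨natDegree_add_le_of_degree_le hP ?_, ?_⟩
  · exact natDegree_le_iff_coeff_eq_zero.2 fun k hk => by
      rw [coeff_neg_one_pow_mul, coeff_eq_zero_of_natDegree_lt
        ((natDegree_antipodalDual_le hP).trans_lt hk), mul_zero]
  · rw [map_add, hdual, mul_add, ← mul_assoc, ← pow_add, (Even.add_self d).neg_one_pow, one_mul,
      add_comm]

theorem mul_mem_antipodalReal (hP : P ∈ antipodalReal d) (hS : S ∈ antipodalReal e) :
    P * S ∈ antipodalReal (d + e) := by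
  refine ⟨natDegree_mul_le.trans (by linarith [hP.1, hS.1]), ?_⟩
  rw [mul_add, antipodalDual_mul hP.1 hS.1, hP.2, hS.2]
  ring

theorem one_mem_antipodalReal : (1 : ℂ[X]) ∈ antipodalReal 0 :=
  ⟨by simp, by simpa using antipodalDual_zero_one⟩

theorem prod_mem_antipodalReal {ι : Type*} (s : Finset ι) {n : ι → ℕ} {f : ι → ℂ[X]}
    (hf : ∀ i ∈ s, f i ∈ antipodalReal (n i)) : ∏ i ∈ s, f i ∈ antipodalReal (∑ i ∈ s, n i) := by
  classical
  induction s using Finset.induction_on with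
  | empty => simpa using one_mem_antipodalReal
  | insert i s hi ih =>
    rw [Finset.forall_mem_insert] at hf
    rw [Finset.sum_insert hi, Finset.prod_insert hi]
    exact mul_mem_antipodalReal hf.1 (ih hf.2)

theorem mem_antipodalReal_of_mul_mem (hP : P ∈ antipodalReal d) (h0 : P ≠ 0)
    (h : P * S ∈ antipodalReal (d + e)) (hS : S.natDegree ≤ 2 * e) : S ∈ antipodalReal e := by
  refine ⟨hS, mul_left_cancel₀ (mul_ne_zero (pow_ne_zero d (by simp)) h0 : (-1) ^ d * P ≠ 0) ?_⟩
  have hdual := h.2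
  rw [mul_add, antipodalDual_mul hP.1 hS, hP.2] at hdual
  rw [hdual]
  ring

theorem mul_antipodalDual_mem_antipodalReal (hP : P.natDegree ≤ d) :
    P * antipodalDual d P ∈ antipodalReal d := by
  have hP' := natDegree_antipodalDual_le hP
  refine ⟨natDegree_mul_le.trans (by linarith), ?_⟩
  rw [two_mul, antipodalDual_mul hP hP', antipodalDual_antipodalDual hP]
  ring

theorem mul_antipodalDual_add_mem_antipodalReal (hP : P.natDegree ≤ d) (hS : S.natDegree ≤ d) :
    S * antipodalDual d P + P * antipodalDual d S ∈ antipodalReal d := by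
  have hP' := natDegree_antipodalDual_le hP
  have h := add_antipodalDual_mem_antipodalReal (d := d) (P := S * antipodalDual d P)
    (natDegree_mul_le.trans (by linarith))
  rwa [two_mul, antipodalDual_mul hS hP', antipodalDual_antipodalDual hP, mul_left_comm,
    ← mul_assoc ((-1) ^ d), ← pow_add, (Even.add_self d).neg_one_pow, one_mul,
    mul_comm _ P] at h

end AntipodalReal

/-- The coefficients of degree less than `d` and the real part of the coefficient of degree `d`.
On `antipodalReal d` these are linear coordinates. -/
def antipodalCoeffs (d : ℕ) : ℂ[X] →ₗ[ℝ] (Fin d → ℂ) × ℝ where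
  toFun P := (fun k => P.coeff k, (P.coeff d).re)
  map_add' P S := by ext <;> simp
  map_smul' t P := by ext <;> simp

section AntipodalCoeffs

variable {d : ℕ} {P : ℂ[X]}

theorem antipodalCoeffs_apply (P : ℂ[X]) :
    antipodalCoeffs d P = (fun k : Fin d => P.coeff k, (P.coeff d).re) :=
  rfl

theorem eq_zero_of_antipodalCoeffs_eq_zero (hP : P ∈ antipodalReal d)
    (h : antipodalCoeffs d P = 0) : P = 0 := by
  have hlow : ∀ k < d, P.coeff k = 0 := fun k hk => congrFun (congrArg Prod.fst h) ⟨k, hk⟩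
  ext k
  rw [coeff_zero]
  rcases lt_trichotomy k d with hk | rfl | hk
  · exact hlow k hk
  · have hre : (P.coeff k).re = 0 := congrArg Prod.snd h
    have hreal := coeff_eq_of_mem_antipodalReal hP (k := k) (by lia)
    rw [(Even.add_self k).neg_one_pow, one_mul, show 2 * k - k = k by lia] at hreal
    exact Complex.ext hre (Complex.conj_eq_iff_im.1 hreal.symm)
  · rcases le_or_gt k (2 * d) with hk' | hk'
    · rw [coeff_eq_of_mem_antipodalReal hP hk', hlow _ (by lia), map_zero, mul_zero]
    · exact coeff_eq_zero_of_natDegree_lt (hP.1.trans_lt hk')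

theorem antipodalCoeffs_injOn : Set.InjOn (antipodalCoeffs d) (antipodalReal d) :=
  fun _ hP _ hS h => sub_eq_zero.1 <| eq_zero_of_antipodalCoeffs_eq_zero (sub_mem hP hS) <| by
    rw [map_sub, h, sub_self]

end AntipodalCoeffs

/-! ### Polynomials with prescribed lower coefficients -/

section MonicPoly

variable {R : Type*} [Semiring R] [DecidableEq R] {d : ℕ}

/-- The monic polynomial of degree `d` with the lower coefficients `a`. -/
def monicPoly (a : Fin d → R) : R[X] := X ^ d + ofFn d a

theorem monic_monicPoly (a : Fin d → R) : (monicPoly a).Monic :=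
  monic_X_pow_add (ofFn_degree_lt a)

theorem degree_monicPoly [Nontrivial R] (a : Fin d → R) : (monicPoly a).degree = d := by
  rw [monicPoly, degree_add_eq_left_of_degree_lt, degree_X_pow]
  exact (ofFn_degree_lt a).trans_eq (degree_X_pow d).symm

theorem natDegree_monicPoly [Nontrivial R] (a : Fin d → R) : (monicPoly a).natDegree = d :=
  natDegree_eq_of_degree_eq_some (degree_monicPoly a)

theorem coeff_monicPoly (a : Fin d → R) (k : Fin d) : (monicPoly a).coeff k = a k := by
  simp [monicPoly, coeff_X_pow, k.2.ne]

theorem monicPoly_coeff {P : R[X]} (hP : P.Monic) (hd : P.natDegree = d) :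
    monicPoly (fun k : Fin d => P.coeff k) = P := by
  ext k
  rcases lt_trichotomy k d with hk | rfl | hk
  · exact coeff_monicPoly _ ⟨k, hk⟩
  · simp [monicPoly, ← hd, hP.coeff_natDegree]
  · simp [monicPoly, hk.le, coeff_X_pow, hk.ne', coeff_eq_zero_of_natDegree_lt (hd.trans_lt hk)]

theorem monicPoly_injective : Function.Injective (monicPoly : (Fin d → R) → R[X]) := fun a b h => by
  funext k
  rw [← coeff_monicPoly a k, h, coeff_monicPoly]

theorem contDiff_coeff_monicPoly {𝕜 : Type*} [NontriviallyNormedField 𝕜] [CompleteSpace 𝕜]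
    [DecidableEq 𝕜] (i : ℕ) {n : WithTop ℕ∞} :
    ContDiff 𝕜 n fun a : Fin d → 𝕜 => (monicPoly a).coeff i := by
  have hlow : ContDiff 𝕜 n fun a : Fin d → 𝕜 => (ofFn d a).coeff i :=
    (lcoeff 𝕜 i ∘ₗ ofFn d).toContinuousLinearMap.contDiff
  simpa only [monicPoly, coeff_add] using contDiff_const.add hlow

theorem monicPoly_rootCoeffs (w : Fin d → ℂ) :
    monicPoly (rootCoeffs w) = ∏ j, (X - C (w j)) :=
  monicPoly_coeff (monic_prod_of_monic _ _ fun _ _ => monic_X_sub_C _) (by simp)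

theorem exists_rootCoeffs_eq (a : Fin d → ℂ) : ∃ w : Fin d → ℂ, rootCoeffs w = a := by
  have hs := IsAlgClosed.splits (monicPoly a)
  obtain ⟨l, hl⟩ := Quotient.exists_rep (monicPoly a).roots
  have hcard : l.length = d := by
    rw [← natDegree_monicPoly a, hs.natDegree_eq_card_roots, ← hl]
    rfl
  subst hcard
  refine ⟨l.get, monicPoly_injective ?_⟩
  rw [monicPoly_rootCoeffs, hs.eq_prod_roots_of_monic (monic_monicPoly a), ← hl, ← List.prod_ofFn]
  exact congrArg List.prod (List.ofFn_getElem_eq_map l fun w => X - C w)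

theorem isRoot_monicPoly_rootCoeffs {w : Fin d → ℂ} {z : ℂ} :
    (monicPoly (rootCoeffs w)).IsRoot z ↔ ∃ j, z = w j := by
  simp [monicPoly_rootCoeffs, IsRoot.def, eval_prod, Finset.prod_eq_zero_iff, sub_eq_zero]

theorem exists_perm_of_multiset_map_eq {ι α : Type*} [Fintype ι] {f g : ι → α}
    (h : Finset.univ.val.map f = Finset.univ.val.map g) : ∃ σ : Equiv.Perm ι, g = f ∘ σ := by
  classical
  have hcard (c : α) : Fintype.card {i // g i = c} = Fintype.card {i // f i = c} := by
    have hcount := congrArg (Multiset.count c) h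
    rw [Multiset.count_map, Multiset.count_map] at hcount
    rw [Fintype.card_subtype, Fintype.card_subtype]
    simpa [Finset.card, eq_comm] using hcount.symm
  exact ⟨Equiv.ofFiberEquiv fun c => Fintype.equivOfCardEq (hcard c),
    funext fun i => (Equiv.ofFiberEquiv_map _ i).symm⟩

theorem exists_perm_of_rootCoeffs_eq {w z : Fin d → ℂ} (h : rootCoeffs w = rootCoeffs z) :
    ∃ σ : Equiv.Perm (Fin d), z = w ∘ σ := by
  have hroots (f : Fin d → ℂ) : (monicPoly (rootCoeffs f)).roots = Finset.univ.val.map f := by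
    rw [monicPoly_rootCoeffs, ← roots_multiset_prod_X_sub_C (Finset.univ.val.map f),
      Multiset.map_map]
    rfl
  exact exists_perm_of_multiset_map_eq (by rw [← hroots, h, hroots])

end MonicPoly

theorem exists_mem_antipodalReal_antipodalCoeffs_eq {d : ℕ} (x : (Fin d → ℂ) × ℝ) :
    ∃ P ∈ antipodalReal d, antipodalCoeffs d P = x := by
  let S : ℂ[X] := ofFn d x.1 + monomial d ((x.2 / 2 : ℝ) : ℂ)
  have hlow (k : Fin d) : S.coeff k = x.1 k := by simp [S, coeff_monomial, k.2.ne']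
  have hmid : S.coeff d = (x.2 / 2 : ℝ) := by simp [S]
  have hhigh (k : ℕ) (hk : d < k) : S.coeff k = 0 := by simp [S, hk.le, coeff_monomial, hk.ne]
  refine ⟨_, add_antipodalDual_mem_antipodalReal (P := S) (d := d) ?_, ?_⟩
  · exact natDegree_le_iff_coeff_eq_zero.2 fun k hk => hhigh k (by lia)
  · rw [antipodalCoeffs_apply]
    refine Prod.ext (funext fun k => ?_) ?_ <;> dsimp only
    · rw [coeff_add, coeff_neg_one_pow_mul, coeff_antipodalDual (by lia), hlow, hhigh _ (by lia),
        map_zero, mul_zero, mul_zero, add_zero]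
    · rw [coeff_add, coeff_neg_one_pow_mul, coeff_antipodalDual (by lia), ← mul_assoc, ← pow_add,
        (Even.add_self d).neg_one_pow, one_mul, two_mul, Nat.add_sub_cancel, hmid,
        Complex.conj_ofReal, ← Complex.ofReal_add, Complex.ofReal_re, add_halves]

/-! ### Factorization into antipodal pairs -/

/-- The antipodally real quadratic polynomial with the antipodal roots `w` and `-1 / conj w`. -/
def antipodalPair (w : ℂ) : ℂ[X] := (X - C w) * (1 + C (conj w) * X)

section AntipodalPair

theorem antipodalPair_mem_antipodalReal (w : ℂ) : antipodalPair w ∈ antipodalReal 1 := by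
  rw [antipodalPair, ← antipodalDual_X_sub_C]
  exact mul_antipodalDual_mem_antipodalReal (natDegree_X_sub_C_le w)

theorem antipodalPair_ne_zero (w : ℂ) : antipodalPair w ≠ 0 :=
  mul_ne_zero (X_sub_C_ne_zero w) fun h => by simpa using congrArg (coeff · 0) h

theorem antipodalPair_eq (w : ℂ) :
    antipodalPair w = C (conj w) * X ^ 2 + C ((1 - ‖w‖ ^ 2 : ℝ) : ℂ) * X - C w := by
  have hnorm : ((1 - ‖w‖ ^ 2 : ℝ) : ℂ) = 1 - w * conj w := by
    rw [Complex.mul_conj']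
    push_cast
    rfl
  rw [antipodalPair, hnorm]
  simp only [map_sub, map_one, map_mul]
  ring

theorem natDegree_antipodalPair {w : ℂ} (hw : w ≠ 0) : (antipodalPair w).natDegree = 2 := by
  have : conj w ≠ 0 := star_ne_zero.2 hw
  rw [antipodalPair_eq]
  compute_degree!

variable {d : ℕ} {P S : ℂ[X]} {w : ℂ}

theorem isRoot_antipode_of_mem_antipodalReal (hP : P ∈ antipodalReal d) (hw : P.IsRoot w)
    (h0 : w ≠ 0) : P.IsRoot (-(conj w)⁻¹) := by
  have heval := congrArg (eval w) hP.2
  rw [eval_antipodalDual hP.1 h0, eval_mul, hw, mul_zero, mul_eq_zero, map_eq_zero] at heval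
  exact heval.resolve_left (pow_ne_zero _ (neg_ne_zero.2 h0))

theorem antipodalPair_dvd (hP : P ∈ antipodalReal d) (hw : P.IsRoot w) : antipodalPair w ∣ P := by
  rcases eq_or_ne w 0 with rfl | h0
  · simpa [antipodalPair] using dvd_iff_isRoot.2 hw
  have hconj : conj w ≠ 0 := star_ne_zero.2 h0
  have hpair : 1 + C (conj w) * X = C (conj w) * (X - C (-(conj w)⁻¹)) := by
    rw [mul_sub, ← C_mul, mul_neg, mul_inv_cancel₀ hconj, C_neg, C_1, sub_neg_eq_add, add_comm]
  have hne : w - -(conj w)⁻¹ ≠ 0 := fun h => by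
    have hnorm : w * conj w = -1 := by
      rw [sub_neg_eq_add] at h
      field_simp at h
      linear_combination h
    rw [Complex.mul_conj'] at hnorm
    have : ‖w‖ ^ 2 = -1 := by exact_mod_cast hnorm
    nlinarith [sq_nonneg ‖w‖]
  have hunit : IsUnit (C (conj w)) := isUnit_C.2 hconj.isUnit
  rw [antipodalPair, hpair]
  refine IsCoprime.mul_dvd ?_ (dvd_iff_isRoot.2 hw) (hunit.mul_left_dvd.2 (dvd_iff_isRoot.2 ?_))
  · exact (isCoprime_mul_unit_left_right hunit _ _).2 (isCoprime_X_sub_C_of_isUnit_sub hne.isUnit)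
  · exact isRoot_antipode_of_mem_antipodalReal hP hw h0

theorem natDegree_le_of_antipodalPair_mul_mem
    (h : antipodalPair w * S ∈ antipodalReal (d + 1)) : S.natDegree ≤ 2 * d := by
  rcases eq_or_ne S 0 with rfl | hS
  · simp
  rcases eq_or_ne w 0 with rfl | hw
  · -- An antipodally real polynomial that vanishes at `0` also vanishes at infinity.
    have hX : antipodalPair 0 = X := by simp [antipodalPair]
    rw [hX] at h
    have htop : S.coeff (2 * d + 1) = 0 := by
      have hcoeff := coeff_eq_of_mem_antipodalReal h (k := 2 * (d + 1)) le_rfl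
      rwa [Nat.sub_self, coeff_X_mul_zero, map_zero, mul_zero, mul_add_one, coeff_X_mul] at hcoeff
    have hdeg : S.natDegree ≤ 2 * d + 1 := by
      have := h.1
      rw [natDegree_X_mul hS] at this
      lia
    refine Nat.le_of_lt_succ (hdeg.lt_of_ne fun heq => hS ?_)
    rwa [← heq, coeff_natDegree, leadingCoeff_eq_zero] at htop
  · have hdeg := h.1
    rw [natDegree_mul (antipodalPair_ne_zero w) hS, natDegree_antipodalPair hw] at hdeg
    lia

theorem exists_isRoot_of_mem_antipodalReal (hP : P ∈ antipodalReal (d + 1)) (h0 : P ≠ 0) :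
    ∃ w, P.IsRoot w := by
  refine IsAlgClosed.exists_root P fun hdeg => h0 ?_
  have hdeg' : P.natDegree = 0 := natDegree_eq_of_degree_eq_some hdeg
  have hcoeff := coeff_eq_of_mem_antipodalReal hP (Nat.zero_le _)
  rw [coeff_eq_zero_of_natDegree_lt (n := 2 * (d + 1) - 0) (by lia), map_zero, mul_zero] at hcoeff
  rw [eq_C_of_natDegree_eq_zero hdeg', hcoeff, C_0]

theorem exists_eq_smul_prod_antipodalPair (hP : P ∈ antipodalReal d) (h0 : P ≠ 0) :
    ∃ c : ℝ, c ≠ 0 ∧ ∃ w : Fin d → ℂ, P = c • ∏ j, antipodalPair (w j) := by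
  induction d generalizing P with
  | zero =>
    rw [eq_C_of_natDegree_le_zero hP.1] at h0 ⊢
    have hreal := coeff_eq_of_mem_antipodalReal hP (k := 0) le_rfl
    rw [add_zero, pow_zero, one_mul, mul_zero, Nat.sub_self] at hreal
    obtain ⟨c, hc⟩ := Complex.conj_eq_iff_real.1 hreal.symm
    rw [hc] at h0 ⊢
    refine ⟨c, by rintro rfl; simp at h0, Fin.elim0, ?_⟩
    rw [Fin.prod_univ_zero, ← Complex.coe_smul, smul_eq_C_mul, mul_one]
  | succ d ih =>
    obtain ⟨w, hw⟩ := exists_isRoot_of_mem_antipodalReal hP h0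
    obtain ⟨S, rfl⟩ := antipodalPair_dvd hP hw
    have hS : S ∈ antipodalReal d := mem_antipodalReal_of_mul_mem
      (antipodalPair_mem_antipodalReal w) (antipodalPair_ne_zero w) (by rwa [add_comm 1 d])
      (natDegree_le_of_antipodalPair_mul_mem hP)
    obtain ⟨c, hc, z, rfl⟩ := ih hS (right_ne_zero_of_mul h0)
    refine ⟨c, hc, Fin.cons w z, ?_⟩
    simp only [Fin.prod_univ_succ, Fin.cons_zero, Fin.cons_succ, mul_smul_comm]

end AntipodalPair

/-! ### Injective maps with invertible derivative -/

section InvertibleDeriv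

theorem hasLineDerivAt_of_forall_eq_add {𝕜 E F : Type*} [NontriviallyNormedField 𝕜]
    [NormedAddCommGroup F] [NormedSpace 𝕜 F] [AddCommGroup E] [Module 𝕜 E] {f : E → F} {x y : E}
    {a : F} {g : 𝕜 → F} (hg : ContinuousAt g 0)
    (hf : ∀ t : 𝕜, f (x + t • y) = f x + (t • a + t ^ 2 • g t)) : HasLineDerivAt 𝕜 f a x y := by
  rw [hasLineDerivAt_iff_tendsto_slope_zero]
  have hlim : Filter.Tendsto (fun t => a + t • g t) (nhds 0) (nhds a) := by
    have hcont : ContinuousAt (fun t => a + t • g t) 0 := by fun_prop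
    simpa only [ContinuousAt, zero_smul, add_zero] using hcont
  refine (hlim.mono_left nhdsWithin_le_nhds).congr' ?_
  filter_upwards [self_mem_nhdsWithin] with t ht
  rw [hf, add_sub_cancel_left, smul_add, pow_two, mul_smul, inv_smul_smul₀ ht, inv_smul_smul₀ ht]

variable {𝕜 E F : Type*} [RCLike 𝕜] [NormedAddCommGroup E] [NormedSpace 𝕜 E] [CompleteSpace E]
  [NormedAddCommGroup F] [NormedSpace 𝕜 F] {f : E → F} {s : Set E} {n : WithTop ℕ∞}

theorem map_nhds_eq_of_isInvertible_fderiv {x : E} (hf : ContDiffAt 𝕜 n f x) (hn : n ≠ 0)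
    (hx : (fderiv 𝕜 f x).IsInvertible) : Filter.map f (nhds x) = nhds (f x) := by
  obtain ⟨f', hf'⟩ := hx
  have hderiv : HasFDerivAt f (f' : E →L[𝕜] F) x :=
    hf' ▸ (hf.differentiableAt hn).hasFDerivAt
  exact (hf.hasStrictFDerivAt' hderiv hn).map_nhds_eq_of_equiv

/-- An injective smooth map on an open set with invertible derivatives, as an open partial
homeomorphism. -/
def localDiffeoOfInjOn (hs : IsOpen s) (hn : n ≠ 0) (hf : ∀ x ∈ s, ContDiffAt 𝕜 n f x)
    (hinj : s.InjOn f) (hderiv : ∀ x ∈ s, (fderiv 𝕜 f x).IsInvertible) :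
    OpenPartialHomeomorph E F :=
  OpenPartialHomeomorph.ofContinuousOpenRestrict hinj.bijOn_image.toPartialEquiv
    (fun x hx => (hf x hx).continuousAt.continuousWithinAt)
    (isOpenMap_iff_nhds_le.2 fun ⟨x, hx⟩ => by
      have hmap := map_nhds_eq_of_isInvertible_fderiv (hf x hx) hn (hderiv x hx)
      rw [← map_nhds_subtype_coe_eq_nhds hx (hs.mem_nhds hx), Filter.map_map] at hmap
      exact hmap.ge)
    hs

theorem contDiffAt_localDiffeoOfInjOn_symm (hs : IsOpen s) (hn : n ≠ 0)
    (hf : ∀ x ∈ s, ContDiffAt 𝕜 n f x) (hinj : s.InjOn f)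
    (hderiv : ∀ x ∈ s, (fderiv 𝕜 f x).IsInvertible) {y : F} (hy : y ∈ f '' s) :
    ContDiffAt 𝕜 n (localDiffeoOfInjOn hs hn hf hinj hderiv).symm y := by
  let φ := localDiffeoOfInjOn hs hn hf hinj hderiv
  have hsymm : φ.symm y ∈ s := φ.map_target hy
  obtain ⟨f', hf'⟩ := hderiv _ hsymm
  exact φ.contDiffAt_symm (f₀' := f') hy
    (hf' ▸ ((hf _ hsymm).differentiableAt hn).hasFDerivAt) (hf _ hsymm)

end InvertibleDeriv

/-! ### The coordinate change from roots to coefficients -/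

/-- The map `(p, ν) ↦ ν p p*` from pairs of a monic polynomial and a real number to antipodally
real polynomials, in coordinates. -/
def conicMap (d : ℕ) (x : (Fin d → ℂ) × ℝ) : (Fin d → ℂ) × ℝ :=
  antipodalCoeffs d (x.2 • (monicPoly x.1 * antipodalDual d (monicPoly x.1)))

/-- The lower coefficients of the monic polynomials with all roots in the open unit disc. -/
def discRootSet (d : ℕ) : Set (Fin d → ℂ) := {a | ∀ z, (monicPoly a).IsRoot z → ‖z‖ < 1}

section ConicMap

variable {d : ℕ} {a b : Fin d → ℂ}

theorem rootCoeffs_mem_discRootSet {w : Fin d → ℂ} :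
    rootCoeffs w ∈ discRootSet d ↔ ∀ j, ‖w j‖ < 1 := by
  simp only [discRootSet, Set.mem_ofPred_eq, isRoot_monicPoly_rootCoeffs, forall_exists_index,
    forall_eq_apply_imp_iff]

theorem coeff_zero_antipodalDual_monicPoly (a : Fin d → ℂ) :
    (antipodalDual d (monicPoly a)).coeff 0 = 1 := by
  have hlead := (monic_monicPoly a).coeff_natDegree
  rw [natDegree_monicPoly] at hlead
  rw [coeff_antipodalDual (Nat.zero_le d), Nat.sub_zero, hlead, map_one, pow_zero, one_mul]

theorem antipodalDual_monicPoly_ne_zero (a : Fin d → ℂ) : antipodalDual d (monicPoly a) ≠ 0 :=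
  fun h => by simpa [h] using coeff_zero_antipodalDual_monicPoly a

theorem mem_discRootSet_iff_eval_antipodalDual_ne_zero :
    a ∈ discRootSet d ↔
      ∀ z ∈ Metric.closedBall 0 1, (antipodalDual d (monicPoly a)).eval z ≠ 0 := by
  simp only [mem_closedBall_zero_iff]
  constructor
  · intro ha z hz h
    have h0 : z ≠ 0 := by
      rintro rfl
      rw [← coeff_zero_eq_eval_zero, coeff_zero_antipodalDual_monicPoly] at h
      exact one_ne_zero h
    rw [eval_antipodalDual (natDegree_monicPoly a).le h0, mul_eq_zero, map_eq_zero] at h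
    have hroot := ha _ (h.resolve_left (pow_ne_zero _ (neg_ne_zero.2 h0)))
    rw [norm_neg, norm_inv, Complex.norm_conj, inv_lt_one₀ (norm_pos_iff.2 h0)] at hroot
    exact hroot.not_ge hz
  · intro h z hz
    by_contra! hnorm
    have h0 : z ≠ 0 := norm_pos_iff.1 (one_pos.trans_le hnorm)
    refine h (-(conj z)⁻¹) (by simpa using inv_le_one_of_one_le₀ hnorm) ?_
    rw [eval_antipodalDual (natDegree_monicPoly a).le (by simpa using h0)]
    simp [hz.eq_zero]

theorem isCoprime_monicPoly_antipodalDual (ha : a ∈ discRootSet d) (hb : b ∈ discRootSet d) :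
    IsCoprime (monicPoly a) (antipodalDual d (monicPoly b)) := by
  rw [isCoprime_iff_aeval_ne_zero_of_isAlgClosed ℂ ℂ]
  simp only [coe_aeval_eq_eval]
  refine fun z => or_iff_not_imp_left.2 fun hz => ?_
  exact mem_discRootSet_iff_eval_antipodalDual_ne_zero.1 hb z
    (mem_closedBall_zero_iff.2 (ha z (not_not.1 hz)).le)

theorem contDiff_coeff_antipodalDual_monicPoly {k : ℕ} (hk : k ≤ d) :
    ContDiff ℝ ∞ fun a : Fin d → ℂ => (antipodalDual d (monicPoly a)).coeff k := by
  simp only [coeff_antipodalDual hk]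
  exact contDiff_const.mul (Complex.conjCLE.contDiff.comp
    ((contDiff_coeff_monicPoly _).restrict_scalars ℝ))

theorem isOpen_discRootSet : IsOpen (discRootSet d) := by
  have hcont : Continuous fun x : (Fin d → ℂ) × ℂ =>
      (antipodalDual d (monicPoly x.1)).eval x.2 := by
    have hdeg (a : Fin d → ℂ) : (antipodalDual d (monicPoly a)).natDegree < d + 1 :=
      Nat.lt_succ_of_le (natDegree_antipodalDual_le (natDegree_monicPoly a).le)
    simp only [eval_eq_sum_range' (hdeg _)]
    refine continuous_finsetSum _ fun k hk => .mul ?_ (continuous_snd.pow k)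
    exact (contDiff_coeff_antipodalDual_monicPoly (Finset.mem_range_succ_iff.1 hk)).continuous.comp
      continuous_fst
  refine isOpen_iff_mem_nhds.2 fun a ha => ?_
  rw [mem_discRootSet_iff_eval_antipodalDual_ne_zero] at ha
  have hnear := (isCompact_closedBall (0 : ℂ) 1).eventually_forall_of_forall_eventually
    (P := fun b z => (antipodalDual d (monicPoly b)).eval z ≠ 0)
    fun z hz => hcont.continuousAt.eventually_ne (ha z hz)
  exact hnear.mono fun b hb => mem_discRootSet_iff_eval_antipodalDual_ne_zero.2 hb

theorem isOpen_discRootSet_prod : IsOpen (discRootSet d ×ˢ ({0}ᶜ : Set ℝ)) :=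
  isOpen_discRootSet.prod isOpen_compl_singleton

theorem contDiff_conicMap : ContDiff ℝ ∞ (conicMap d) := by
  have hcoeff : ∀ k ≤ d, ContDiff ℝ ∞ fun x : (Fin d → ℂ) × ℝ =>
      (x.2 • (monicPoly x.1 * antipodalDual d (monicPoly x.1))).coeff k := by
    intro k hk
    simp only [coeff_smul, coeff_mul]
    refine contDiff_snd.smul (ContDiff.sum fun ij hij => ?_)
    have hj : ij.2 ≤ d := (Finset.HasAntidiagonal.antidiagonal.snd_le hij).trans hk
    exact (((contDiff_coeff_monicPoly _).restrict_scalars ℝ).comp contDiff_fst).mul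
      ((contDiff_coeff_antipodalDual_monicPoly hj).comp contDiff_fst)
  exact (contDiff_pi.2 fun k : Fin d => hcoeff k k.2.le).prodMk
    (Complex.reCLM.contDiff.comp (hcoeff d le_rfl))

theorem conicMap_smul (a : Fin d → ℂ) (s t : ℝ) :
    conicMap d (a, s * t) = s • conicMap d (a, t) := by
  simp only [conicMap, mul_smul, map_smul]

theorem smul_mul_antipodalDual_mem_antipodalReal (a : Fin d → ℂ) (t : ℝ) :
    t • (monicPoly a * antipodalDual d (monicPoly a)) ∈ antipodalReal d :=
  Submodule.smul_mem _ t (mul_antipodalDual_mem_antipodalReal (natDegree_monicPoly a).le)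

theorem monicPoly_dvd_of_smul_eq (ha : a ∈ discRootSet d) (hb : b ∈ discRootSet d) {s t : ℝ}
    (ht : t ≠ 0) (h : s • (monicPoly a * antipodalDual d (monicPoly a)) =
      t • (monicPoly b * antipodalDual d (monicPoly b))) : monicPoly a ∣ monicPoly b := by
  refine (isCoprime_monicPoly_antipodalDual ha hb).dvd_of_dvd_mul_right
    (Dvd.intro ((t⁻¹ * s) • antipodalDual d (monicPoly a)) ?_)
  rw [mul_smul_comm, mul_smul, h, inv_smul_smul₀ ht]

theorem injOn_conicMap : Set.InjOn (conicMap d) (discRootSet d ×ˢ {0}ᶜ) := by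
  rintro ⟨a, s⟩ ⟨ha, hs⟩ ⟨b, t⟩ ⟨hb, ht⟩ h
  have hP := antipodalCoeffs_injOn (smul_mul_antipodalDual_mem_antipodalReal a s)
    (smul_mul_antipodalDual_mem_antipodalReal b t) h
  obtain rfl : a = b := monicPoly_injective
    (eq_of_monic_of_associated (monic_monicPoly a) (monic_monicPoly b)
      (associated_of_dvd_dvd (monicPoly_dvd_of_smul_eq ha hb ht hP)
        (monicPoly_dvd_of_smul_eq hb ha hs hP.symm)))
  rw [smul_left_injective ℝ
    (mul_ne_zero (monic_monicPoly a).ne_zero (antipodalDual_monicPoly_ne_zero a)) hP]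

theorem fderiv_conicMap_apply (x y : (Fin d → ℂ) × ℝ) :
    fderiv ℝ (conicMap d) x y = antipodalCoeffs d
      (y.2 • (monicPoly x.1 * antipodalDual d (monicPoly x.1)) + x.2 •
        (ofFn d y.1 * antipodalDual d (monicPoly x.1) +
          monicPoly x.1 * antipodalDual d (ofFn d y.1))) := by
  rw [← (contDiff_conicMap.differentiable (by simp) x).lineDeriv_eq_fderiv]
  generalize hp : monicPoly x.1 = p
  generalize hr : ofFn d y.1 = r
  let A := x.2 • (r * antipodalDual d r) +
    y.2 • (r * antipodalDual d p + p * antipodalDual d r)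
  let B := y.2 • (r * antipodalDual d r)
  refine (hasLineDerivAt_of_forall_eq_add
    (g := fun t => antipodalCoeffs d A + t • antipodalCoeffs d B) (by fun_prop)
    fun t => ?_).lineDeriv
  have hmonic : monicPoly (x + t • y).1 = p + t • r := by
    simp only [← hp, ← hr, monicPoly, Prod.fst_add, Prod.smul_fst, map_add, add_assoc]
    rw [← Complex.coe_smul, ← Complex.coe_smul, map_smul]
  simp only [conicMap, hmonic, hp, A, B, antipodalDual_real_smul, Prod.snd_add, Prod.smul_snd,
    map_add, map_smul, mul_add, add_mul, smul_add, smul_mul_assoc, mul_smul_comm]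
  module

theorem fderiv_conicMap_injective {x : (Fin d → ℂ) × ℝ} (hx : x ∈ discRootSet d ×ˢ {0}ᶜ) :
    Function.Injective (fderiv ℝ (conicMap d) x) := by
  refine (injective_iff_map_eq_zero _).2 fun y hy => ?_
  rw [fderiv_conicMap_apply] at hy
  set p := monicPoly x.1 with hp
  set r : ℂ[X] := ofFn d y.1 with hr
  have hpd : p.natDegree = d := natDegree_monicPoly x.1
  have hrd : r.natDegree ≤ d := natDegree_le_of_degree_le (ofFn_degree_lt y.1).le
  have hsum : y.2 • (p * antipodalDual d p) +
      x.2 • (r * antipodalDual d p + p * antipodalDual d r) = 0 :=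
    eq_zero_of_antipodalCoeffs_eq_zero
      (add_mem (smul_mul_antipodalDual_mem_antipodalReal x.1 y.2) (Submodule.smul_mem _ _
        (mul_antipodalDual_add_mem_antipodalReal hpd.le hrd))) hy
  have hdvd : p ∣ r := by
    refine (isCoprime_monicPoly_antipodalDual hx.1 hx.1).dvd_of_dvd_mul_right
      (Dvd.intro (-(x.2⁻¹ • y.2 • antipodalDual d p) - antipodalDual d r) ?_)
    rw [← hp]
    have hsum' := congrArg (x.2⁻¹ • ·) hsum
    simp only [smul_add, inv_smul_smul₀ hx.2, smul_zero] at hsum'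
    rw [mul_sub, mul_neg, mul_smul_comm, mul_smul_comm]
    linear_combination -hsum'
  have hr0 : r = 0 := eq_zero_of_dvd_of_degree_lt hdvd
    ((ofFn_degree_lt y.1).trans_eq (degree_monicPoly x.1).symm)
  rw [hr0, map_zero, zero_mul, mul_zero, add_zero, smul_zero, add_zero, smul_eq_zero] at hsum
  refine Prod.ext (injective_ofFn d (by rw [← hr, hr0, Prod.fst_zero, map_zero]))
    (hsum.resolve_right (mul_ne_zero (monic_monicPoly _).ne_zero
      (antipodalDual_monicPoly_ne_zero _)))

theorem isInvertible_fderiv_conicMap {x : (Fin d → ℂ) × ℝ} (hx : x ∈ discRootSet d ×ˢ {0}ᶜ) :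
    (fderiv ℝ (conicMap d) x).IsInvertible :=
  ⟨(LinearEquiv.ofInjectiveEndo (fderiv ℝ (conicMap d) x : ((Fin d → ℂ) × ℝ) →ₗ[ℝ] _)
    (fderiv_conicMap_injective hx)).toContinuousLinearEquiv, rfl⟩

/-- `conicMap` as an open partial homeomorphism. -/
def conicMapHomeo (d : ℕ) : OpenPartialHomeomorph ((Fin d → ℂ) × ℝ) ((Fin d → ℂ) × ℝ) :=
  localDiffeoOfInjOn isOpen_discRootSet_prod (by simp) (fun _ _ => contDiff_conicMap.contDiffAt)
    injOn_conicMap fun _ => isInvertible_fderiv_conicMap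

@[simp] theorem coe_conicMapHomeo : ⇑(conicMapHomeo d) = conicMap d := rfl

theorem contDiffOn_conicMapHomeo_symm :
    ContDiffOn ℝ ∞ (conicMapHomeo d).symm (conicMapHomeo d).target := fun _ hy =>
  (contDiffAt_localDiffeoOfInjOn_symm isOpen_discRootSet_prod (by simp)
    (fun _ _ => contDiff_conicMap.contDiffAt) injOn_conicMap
    (fun _ => isInvertible_fderiv_conicMap) hy).contDiffWithinAt

end ConicMap

/-! ### Orthonormal frames -/

theorem exists_orthonormal_basis_of_posDef {E : Type*} [AddCommGroup E] [Module ℝ E]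
    [FiniteDimensional ℝ E] {ι : Type*} [Fintype ι] (hι : Module.finrank ℝ E = Fintype.card ι)
    {Q : QuadraticForm ℝ E} (hQ : Q.PosDef) (i₀ : ι) {x : E} (hx : Q x = 1) :
    ∃ v : ι → E, v i₀ = x ∧ (∀ i, Q (v i) = 1) ∧
      ∀ i j, i ≠ j → QuadraticMap.IsOrtho Q (v i) (v j) := by
  let B := QuadraticMap.associated (R := ℝ) Q
  have hB (y : E) : B y y = Q y := QuadraticMap.associated_eq_self_apply ℝ Q y
  let core : InnerProductSpace.Core ℝ E :=
    { inner := fun y z => B y z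
      conj_inner_symm := fun y z => QuadraticMap.associated_isSymm ℝ Q z y
      re_inner_nonneg := fun y => (hQ.nonneg y).trans_eq (hB y).symm
      add_left := fun y z w => by simp
      smul_left := fun y z r => by simp
      definite := fun y h => hQ.anisotropic y ((hB y).symm.trans h) }
  let _ : NormedAddCommGroup E := core.toNormedAddCommGroup
  let _ : InnerProductSpace ℝ E := InnerProductSpace.ofCore core.toCore
  have hinner (y z : E) : inner ℝ y z = B y z := rfl
  have hon : Orthonormal ℝ (({i₀} : Set ι).domRestrict fun _ => x) := by
    refine ⟨fun _ => ?_, fun i j hij => (hij (Subsingleton.elim i j)).elim⟩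
    have : ‖x‖ ^ 2 = 1 := by rw [← real_inner_self_eq_norm_sq, hinner, hB, hx]
    exact (pow_eq_one_iff_of_nonneg (norm_nonneg x) two_ne_zero).1 this
  obtain ⟨b, hb⟩ := hon.exists_orthonormalBasis_extension_of_card_eq hι
  refine ⟨b, hb i₀ rfl, fun i => ?_, fun i j hij => ?_⟩
  · rw [← hB, ← hinner, real_inner_self_eq_norm_sq, b.orthonormal.1 i, one_pow]
  · rw [← QuadraticMap.associated_isOrtho]
    exact b.orthonormal.2 hij

theorem exists_forall_dotProduct_ne_zero {K ι n : Type*} [Field K] [Infinite K] [Finite ι]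
    [Fintype n] (L : ι → n → K) (hL : ∀ i, L i ≠ 0) : ∃ x : n → K, ∀ i, L i ⬝ᵥ x ≠ 0 := by
  classical
  obtain ⟨f, hf⟩ := Module.exists_dual_forall_apply_ne_zero (K := K) L hL
  refine ⟨fun k => f fun j => if k = j then 1 else 0, fun i => ?_⟩
  have := hf i
  rwa [LinearMap.pi_apply_eq_sum_univ f (L i)] at this

theorem exists_isOrthonormalFrame {Q : QuadraticForm ℝ (Fin 3 → ℝ)} (hQ : Q.PosDef) {ι : Type*}
    [Finite ι] (L : ι → LinForm) :
    ∃ v, IsOrthonormalFrame Q v ∧ ∀ i, frameValue v 2 (L i).1 ≠ 0 := by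
  obtain ⟨x, hx⟩ := exists_forall_dotProduct_ne_zero
    (fun i : Option ι => i.elim (Pi.single 0 1 : Fin 3 → ℝ) fun i => (L i).1) (by
      rintro (_ | i)
      · simp
      · exact (L i).2)
  have hpos : 0 < Q x := hQ x fun h => hx none (by rw [h, dotProduct_zero])
  obtain ⟨v, hv, hframe⟩ := exists_orthonormal_basis_of_posDef (ι := Fin 3) (by simp) hQ 2
    (x := (Real.sqrt (Q x))⁻¹ • x) (by
      rw [QuadraticMap.map_smul, smul_eq_mul, ← mul_inv, Real.mul_self_sqrt hpos.le,
        inv_mul_cancel₀ hpos.ne'])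
  refine ⟨v, hframe, fun i => ?_⟩
  rw [frameValue, hv, dotProduct_smul]
  exact smul_ne_zero (inv_ne_zero (Real.sqrt_pos.2 hpos).ne') (hx (some i))

/-- The values of a linear form on the vectors of a frame, as a linear map. -/
def frameValues (v : Fin 3 → (Fin 3 → ℝ)) : (Fin 3 → ℝ) →ₗ[ℝ] (Fin 3 → ℝ) :=
  (Matrix.of v).transpose.vecMulLinear

theorem frameValues_apply (v : Fin 3 → (Fin 3 → ℝ)) (L : Fin 3 → ℝ) (i : Fin 3) :
    frameValues v L i = frameValue v i L := rfl

namespace IsOrthonormalFrame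

open Matrix

variable {Q : QuadraticForm ℝ (Fin 3 → ℝ)} {v v' : Fin 3 → (Fin 3 → ℝ)}

theorem gram_eq_one (hv : IsOrthonormalFrame Q v) : of v * Q.toMatrix' * (of v)ᵀ = 1 := by
  have hB : Matrix.toLinearMap₂' ℝ Q.toMatrix' = QuadraticMap.associated (R := ℝ) Q :=
    Matrix.toLinearMap₂'_toMatrix' _
  ext i j
  have hentry : (of v * Q.toMatrix' * (of v)ᵀ) i j =
      QuadraticMap.associated (R := ℝ) Q (v i) (v j) := by
    rw [← hB, Matrix.toLinearMap₂'_apply', dotProduct_mulVec]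
    rfl
  rw [hentry, Matrix.one_apply]
  split_ifs with h
  · rw [h]
    exact (QuadraticMap.associated_eq_self_apply ℝ Q _).trans (hv.1 j)
  · exact QuadraticMap.associated_isOrtho.2 (hv.2 i j h)

theorem isUnit_of (hv : IsOrthonormalFrame Q v) : IsUnit (of v) :=
  .of_mul_eq_one _ ((Matrix.mul_assoc _ _ _).symm.trans hv.gram_eq_one)

theorem frameValues_bijective (hv : IsOrthonormalFrame Q v) :
    Function.Bijective (frameValues v) :=
  have h : IsUnit (of v)ᵀ := (Matrix.isUnit_transpose _).2 hv.isUnit_of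
  ⟨Matrix.vecMul_injective_iff_isUnit.2 h, Matrix.vecMul_surjective_iff_isUnit.2 h⟩

theorem exists_orthogonal (hv : IsOrthonormalFrame Q v) (hv' : IsOrthonormalFrame Q v') :
    ∃ R : Matrix (Fin 3) (Fin 3) ℝ, R * Rᵀ = 1 ∧
      ∀ L, frameValues v' L = R *ᵥ frameValues v L := by
  have hdet : IsUnit (of v).det := (Matrix.isUnit_iff_isUnit_det _).1 hv.isUnit_of
  have hR : of v' * (of v)⁻¹ * of v = of v' := Matrix.nonsing_inv_mul_cancel_right _ _ hdet
  refine ⟨of v' * (of v)⁻¹, ?_, fun L => ?_⟩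
  · set R := of v' * (of v)⁻¹
    calc R * Rᵀ = R * (of v * Q.toMatrix' * (of v)ᵀ) * Rᵀ := by rw [hv.gram_eq_one, mul_one]
      _ = R * of v * Q.toMatrix' * (R * of v)ᵀ := by
        simp only [Matrix.transpose_mul, Matrix.mul_assoc]
      _ = 1 := by rw [hR, hv'.gram_eq_one]
  · change L ᵥ* (of v')ᵀ = _ *ᵥ (L ᵥ* (of v)ᵀ)
    rw [Matrix.vecMul_transpose, Matrix.vecMul_transpose, Matrix.mulVec_mulVec, hR]

end IsOrthonormalFrame

/-! ### Linear forms on the conic -/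

/-- The coordinates `X² - 1`, `-i (X² + 1)`, `2 X` of the parametrized conic. -/
def conicParam : Fin 3 → ℂ[X] := ![X ^ 2 - 1, -C Complex.I * (X ^ 2 + 1), 2 * X]

/-- The restriction of a linear form to the conic parametrized by means of a frame. -/
def formPoly (v : Fin 3 → (Fin 3 → ℝ)) : (Fin 3 → ℝ) →ₗ[ℝ] ℂ[X] :=
  Fintype.linearCombination ℝ conicParam ∘ₗ frameValues v

section FormPoly

variable {v : Fin 3 → (Fin 3 → ℝ)} {Q : QuadraticForm ℝ (Fin 3 → ℝ)} {L : Fin 3 → ℝ}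

theorem formPoly_apply (v : Fin 3 → (Fin 3 → ℝ)) (L : Fin 3 → ℝ) :
    formPoly v L = ∑ i, frameValues v L i • conicParam i := rfl

theorem formPoly_eq_quadratic {z : ℂ}
    (hz : (frameValue v 0 L : ℂ) + Complex.I * (frameValue v 1 L : ℂ) = z) :
    formPoly v L = C (conj z) * X ^ 2 + C ((2 * frameValue v 2 L : ℝ) : ℂ) * X - C z := by
  subst hz
  simp only [formPoly_apply, frameValues_apply, conicParam, Fin.sum_univ_three, Matrix.cons_val,
    map_add, map_mul, Complex.conj_ofReal, Complex.conj_I, ← Complex.coe_smul, smul_eq_C_mul,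
    Complex.ofReal_mul, Complex.ofReal_ofNat, map_neg, map_ofNat]
  ring

theorem formPoly_mem_antipodalReal (v : Fin 3 → (Fin 3 → ℝ)) (L : Fin 3 → ℝ) :
    formPoly v L ∈ antipodalReal 1 := by
  set z : ℂ := frameValue v 0 L + Complex.I * frameValue v 1 L with hz
  have hpair : formPoly v L = antipodalPair z +
      (2 * frameValue v 2 L - (1 - ‖z‖ ^ 2)) • antipodalPair 0 := by
    rw [formPoly_eq_quadratic hz.symm, antipodalPair_eq, antipodalPair_eq, ← Complex.coe_smul,
      smul_eq_C_mul]
    simp only [map_zero, norm_zero, zero_mul, ne_eq, OfNat.ofNat_ne_zero, not_false_eq_true,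
      zero_pow, sub_zero, Complex.ofReal_sub, Complex.ofReal_one, C_sub, C_1, one_mul, zero_add]
    ring
  rw [hpair]
  exact add_mem (antipodalPair_mem_antipodalReal z)
    (Submodule.smul_mem _ _ (antipodalPair_mem_antipodalReal 0))

theorem IsOrthonormalFrame.formPoly_injective (hv : IsOrthonormalFrame Q v) :
    Function.Injective (formPoly v) := by
  refine (injective_iff_map_eq_zero _).2 fun L h => hv.frameValues_bijective.1 ?_
  rw [formPoly_eq_quadratic rfl] at h
  have h0 := congrArg (coeff · 0) h
  have h1 := congrArg (coeff · 1) h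
  simp only [coeff_sub, coeff_add, coeff_C_mul, coeff_X_pow, coeff_X_zero, coeff_X_one,
    coeff_C_zero, coeff_C_succ, coeff_zero] at h0 h1
  rw [map_zero]
  ext i
  fin_cases i
  · simpa [frameValues_apply] using congrArg Complex.re h0
  · simpa [frameValues_apply] using congrArg Complex.im h0
  · simpa [frameValues_apply] using h1

theorem IsOrthonormalFrame.exists_formPoly_eq (hv : IsOrthonormalFrame Q v) (w : ℂ) :
    ∃ L : LinForm, formPoly v L.1 = antipodalPair w ∧ frameValue v 2 L.1 = (1 - ‖w‖ ^ 2) / 2 := by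
  obtain ⟨L, hL⟩ := hv.frameValues_bijective.2 ![w.re, w.im, (1 - ‖w‖ ^ 2) / 2]
  have hw : (frameValue v 0 L : ℂ) + Complex.I * (frameValue v 1 L : ℂ) = w := by
    rw [← frameValues_apply, ← frameValues_apply, hL]
    exact (congrArg _ (mul_comm _ _)).trans (Complex.re_add_im w)
  have h2 : frameValue v 2 L = (1 - ‖w‖ ^ 2) / 2 := congrFun hL 2
  have hpair : formPoly v L = antipodalPair w := by
    rw [formPoly_eq_quadratic hw, antipodalPair_eq, h2, mul_div_cancel₀ _ two_ne_zero]
  exact ⟨⟨L, fun h => antipodalPair_ne_zero w (by rw [← hpair, h, map_zero])⟩, hpair, h2⟩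

theorem conicScale_sq (hL : frameValue v 2 L ≠ 0) :
    conicScale v L ^ 2 = frameValue v 0 L ^ 2 + frameValue v 1 L ^ 2 +
      2 * frameValue v 2 L * conicScale v L := by
  have hs : Real.sign (frameValue v 2 L) ^ 2 = 1 := by
    rcases Real.sign_apply_eq_of_ne_zero _ hL with h | h <;> rw [h] <;> norm_num
  have hq := Real.sq_sqrt (show
    0 ≤ frameValue v 0 L ^ 2 + frameValue v 1 L ^ 2 + frameValue v 2 L ^ 2 by positivity)
  rw [conicScale]
  linear_combination hs * Real.sqrt (frameValue v 0 L ^ 2 + frameValue v 1 L ^ 2 +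
    frameValue v 2 L ^ 2) ^ 2 + hq

theorem conicScale_mul_frameValue_pos (hL : frameValue v 2 L ≠ 0) :
    0 < conicScale v L * frameValue v 2 L := by
  have hs : 0 < Real.sign (frameValue v 2 L) * frameValue v 2 L :=
    Real.sign_mul_pos_of_ne_zero _ hL
  have hsq : 0 < frameValue v 2 L * frameValue v 2 L := mul_self_pos.2 hL
  rw [conicScale, add_mul, mul_right_comm]
  positivity

theorem conicScale_ne_zero (hL : frameValue v 2 L ≠ 0) : conicScale v L ≠ 0 :=
  left_ne_zero_of_mul (conicScale_mul_frameValue_pos hL).ne'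

theorem conicScale_mul_one_sub (hL : frameValue v 2 L ≠ 0) :
    conicScale v L * (1 - ‖conicCoord v L‖ ^ 2) = 2 * frameValue v 2 L := by
  have h0 := conicScale_ne_zero hL
  have hnorm : ‖conicCoord v L‖ ^ 2 =
      (frameValue v 0 L ^ 2 + frameValue v 1 L ^ 2) / conicScale v L ^ 2 := by
    rw [conicCoord, mul_comm Complex.I, norm_div, div_pow, Complex.norm_real, Real.norm_eq_abs,
      sq_abs, ← Complex.normSq_eq_norm_sq, Complex.normSq_add_mul_I]
  rw [hnorm]
  field_simp
  linear_combination conicScale_sq hL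

theorem norm_conicCoord_lt_one (hL : frameValue v 2 L ≠ 0) : ‖conicCoord v L‖ < 1 := by
  have hsq : 0 < conicScale v L ^ 2 := sq_pos_of_ne_zero (conicScale_ne_zero hL)
  have hmul : conicScale v L ^ 2 * (1 - ‖conicCoord v L‖ ^ 2) =
      2 * (conicScale v L * frameValue v 2 L) := by
    linear_combination conicScale v L * conicScale_mul_one_sub hL
  have hpos : 0 < 1 - ‖conicCoord v L‖ ^ 2 := pos_of_mul_pos_right
    (hmul ▸ mul_pos two_pos (conicScale_mul_frameValue_pos hL)) hsq.le
  exact (sq_lt_one_iff₀ (norm_nonneg _)).1 (sub_pos.1 hpos)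

theorem formPoly_eq_smul_antipodalPair (hL : frameValue v 2 L ≠ 0) :
    formPoly v L = conicScale v L • antipodalPair (conicCoord v L) := by
  have h0 : (conicScale v L : ℂ) ≠ 0 := Complex.ofReal_ne_zero.2 (conicScale_ne_zero hL)
  rw [formPoly_eq_quadratic (mul_div_cancel₀ _ h0).symm, antipodalPair_eq,
    ← conicScale_mul_one_sub hL, ← Complex.coe_smul, smul_eq_C_mul]
  change C (conj (conicScale v L * conicCoord v L)) * X ^ 2 + _ -
    C (conicScale v L * conicCoord v L) = _
  simp only [map_mul, Complex.conj_ofReal, Complex.ofReal_mul]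
  ring

end FormPoly

/-! ### The multipole map -/

/-- The product of linear forms, restricted to the conic parametrized by means of a frame. -/
def multipolePoly (v : Fin 3 → (Fin 3 → ℝ)) {d : ℕ} (L : Fin d → LinForm) : ℂ[X] :=
  ∏ j, formPoly v (L j).1

section MultipolePoly

variable {v : Fin 3 → (Fin 3 → ℝ)} {Q : QuadraticForm ℝ (Fin 3 → ℝ)} {d : ℕ}

theorem multipolePoly_mem_antipodalReal (v : Fin 3 → (Fin 3 → ℝ)) (L : Fin d → LinForm) :
    multipolePoly v L ∈ antipodalReal d := by
  simpa [multipolePoly] using prod_mem_antipodalReal Finset.univ (n := fun _ => 1) fun j _ =>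
    formPoly_mem_antipodalReal v (L j).1

theorem multipolePoly_scale (v : Fin 3 → (Fin 3 → ℝ)) (c : Fin d → ℝˣ) (L : Fin d → LinForm) :
    multipolePoly v (fun j => LinForm.scale (c j) (L j)) =
      ((∏ j, c j : ℝˣ) : ℝ) • multipolePoly v L := by
  simp only [multipolePoly, LinForm.scale, map_smul, Finset.prod_smul, Units.coe_prod]

theorem multipolePoly_comp_perm (v : Fin 3 → (Fin 3 → ℝ)) (σ : Equiv.Perm (Fin d))
    (L : Fin d → LinForm) : multipolePoly v (L ∘ σ) = multipolePoly v L :=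
  Equiv.prod_comp σ fun j => formPoly v (L j).1

theorem IsOrthonormalFrame.multipolePoly_ne_zero (hv : IsOrthonormalFrame Q v)
    (L : Fin d → LinForm) : multipolePoly v L ≠ 0 :=
  Finset.prod_ne_zero_iff.2 fun j _ => (map_ne_zero_iff _ hv.formPoly_injective).2 (L j).2

theorem IsOrthonormalFrame.exists_multipolePoly_eq [NeZero d] (hv : IsOrthonormalFrame Q v)
    {t : ℝ} (ht : t ≠ 0) (w : Fin d → ℂ) :
    ∃ L : Fin d → LinForm, multipolePoly v L = t • ∏ j, antipodalPair (w j) ∧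
      ∀ j, frameValue v 2 (L j).1 = 0 ↔ ‖w j‖ ^ 2 = 1 := by
  choose L hL hL2 using fun j => hv.exists_formPoly_eq (w j)
  refine ⟨fun j => LinForm.scale ((Pi.mulSingle 0 (Units.mk0 t ht) : Fin d → ℝˣ) j) (L j), ?_,
    fun j => ?_⟩
  · rw [multipolePoly_scale, Fintype.prod_pi_mulSingle']
    simp only [multipolePoly, hL, Units.val_mk0]
  · change frameValue v 2 (_ • (L j).1) = 0 ↔ _
    rw [frameValue_smul, hL2, mul_eq_zero_iff_left (Units.ne_zero _),
      div_eq_zero_iff, sub_eq_zero, eq_comm, or_iff_left two_ne_zero]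

end MultipolePoly

theorem MultipoleSpace.exists_rep {d : ℕ} (m : MultipoleSpace d) : ∃ L, MultipoleSpace.mk L = m :=
  Quotient.exists_rep m

/-- The coordinates of the product of the forms of a multipole, restricted to the conic. -/
def multipoleMap (v : Fin 3 → (Fin 3 → ℝ)) (d : ℕ) : MultipoleSpace d → (Fin d → ℂ) × ℝ :=
  Quotient.lift (fun L => antipodalCoeffs d (multipolePoly v L)) (by
    rintro L M ⟨σ, c, hc, h⟩
    obtain rfl : M = fun j => LinForm.scale (c j) ((L ∘ σ) j) := funext h
    rw [multipolePoly_scale, hc, multipolePoly_comp_perm, Units.val_one, one_smul])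

section MultipoleMap

variable {v v' : Fin 3 → (Fin 3 → ℝ)} {Q : QuadraticForm ℝ (Fin 3 → ℝ)} {d : ℕ}

theorem multipoleMap_mk (v : Fin 3 → (Fin 3 → ℝ)) (L : Fin d → LinForm) :
    multipoleMap v d (.mk L) = antipodalCoeffs d (multipolePoly v L) := rfl

theorem multipoleMap_mk_scale (v : Fin 3 → (Fin 3 → ℝ)) (c : Fin d → ℝˣ) (L : Fin d → LinForm) :
    multipoleMap v d (.mk fun j => LinForm.scale (c j) (L j)) =
      ((∏ j, c j : ℝˣ) : ℝ) • multipoleMap v d (.mk L) := by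
  rw [multipoleMap_mk, multipolePoly_scale, map_smul, multipoleMap_mk]

theorem IsOrthonormalFrame.multipoleMap_ne_zero (hv : IsOrthonormalFrame Q v)
    (m : MultipoleSpace d) : multipoleMap v d m ≠ 0 := by
  obtain ⟨L, rfl⟩ := m.exists_rep
  exact fun h => hv.multipolePoly_ne_zero L
    (eq_zero_of_antipodalCoeffs_eq_zero (multipolePoly_mem_antipodalReal v L) h)

theorem conicMap_rootCoeffs (w : Fin d → ℂ) (t : ℝ) :
    conicMap d (rootCoeffs w, t) = antipodalCoeffs d (t • ∏ j, antipodalPair (w j)) := by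
  simp only [conicMap, monicPoly_rootCoeffs, antipodalDual_prod_X_sub_C, antipodalPair,
    Finset.prod_mul_distrib, map_smul]

theorem MultipoleSpace.chartCoord_mk (v : Fin 3 → (Fin 3 → ℝ)) (L : Fin d → LinForm) :
    chartCoord v d (.mk L) =
      (rootCoeffs fun j => conicCoord v (L j).1, ∏ j, conicScale v (L j).1) := rfl

theorem MultipoleSpace.mapsTo_chartCoord (v : Fin 3 → (Fin 3 → ℝ)) (d : ℕ) :
    Set.MapsTo (chartCoord v d) (chartDomain v d) (discRootSet d ×ˢ {0}ᶜ) := by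
  rintro _ ⟨L, rfl, hL⟩
  exact ⟨rootCoeffs_mem_discRootSet.2 fun j => norm_conicCoord_lt_one (hL j),
    (Finset.prod_ne_zero_iff.2 fun j _ => conicScale_ne_zero (hL j) :
      ∏ j, conicScale v (L j).1 ≠ 0)⟩

theorem eqOn_multipoleMap_conicMap (v : Fin 3 → (Fin 3 → ℝ)) (d : ℕ) :
    Set.EqOn (multipoleMap v d) (conicMap d ∘ MultipoleSpace.chartCoord v d)
      (MultipoleSpace.chartDomain v d) := by
  rintro _ ⟨L, rfl, hL⟩
  rw [multipoleMap_mk, Function.comp_apply, MultipoleSpace.chartCoord_mk, conicMap_rootCoeffs,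
    ← Finset.prod_smul, multipolePoly,
    Finset.prod_congr rfl fun j _ => formPoly_eq_smul_antipodalPair (hL j)]

theorem IsOrthonormalFrame.injOn_chartCoord (hv : IsOrthonormalFrame Q v) :
    Set.InjOn (MultipoleSpace.chartCoord v d) (MultipoleSpace.chartDomain v d) := by
  rintro _ ⟨L, rfl, hL⟩ _ ⟨M, rfl, hM⟩ h
  rw [MultipoleSpace.chartCoord_mk, MultipoleSpace.chartCoord_mk, Prod.mk.injEq] at h
  obtain ⟨σ, hσ⟩ := exists_perm_of_rootCoeffs_eq h.1
  have hL0 := fun j => conicScale_ne_zero (hL j)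
  have hM0 := fun j => conicScale_ne_zero (hM j)
  refine Quotient.sound ⟨σ, fun j => Units.mk0 (conicScale v (M j).1 / conicScale v (L (σ j)).1)
    (div_ne_zero (hM0 j) (hL0 _)), Units.ext ?_, fun j => Subtype.ext (hv.formPoly_injective ?_)⟩
  · simp only [Units.coe_prod, Units.val_mk0, Units.val_one, Finset.prod_div_distrib]
    rw [Equiv.prod_comp σ fun j => conicScale v (L j).1, h.2,
      div_self (Finset.prod_ne_zero_iff.2 fun j _ => hM0 j)]
  · have hj : conicCoord v (M j).1 = conicCoord v (L (σ j)).1 := congrFun hσ j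
    rw [LinForm.scale, map_smul, formPoly_eq_smul_antipodalPair (hM j), hj,
      formPoly_eq_smul_antipodalPair (hL (σ j)), smul_smul, Units.val_mk0,
      div_mul_cancel₀ _ (hL0 _)]

theorem IsOrthonormalFrame.injOn_multipoleMap (hv : IsOrthonormalFrame Q v) :
    Set.InjOn (multipoleMap v d) (MultipoleSpace.chartDomain v d) :=
  (injOn_conicMap.comp hv.injOn_chartCoord (MultipoleSpace.mapsTo_chartCoord v d)).congr
    (eqOn_multipoleMap_conicMap v d).symm

end MultipoleMap

/-! ### Change of frame -/

theorem conicParam_dotProduct_self : conicParam ⬝ᵥ conicParam = 0 := by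
  have hI : (C Complex.I : ℂ[X]) * C Complex.I = -1 := by
    rw [← C_mul, Complex.I_mul_I, C_neg, C_1]
  simp only [dotProduct, Fin.sum_univ_three, conicParam, Matrix.cons_val]
  linear_combination (X ^ 2 + 1) ^ 2 * hI

theorem exists_eval_homogenize_conicParam_eq {x : Fin 3 → ℂ} (hx : x ⬝ᵥ x = 0) :
    ∃ g : Fin 2 → ℂ, ∀ i, MvPolynomial.eval g ((conicParam i).homogenize 2) = x i := by
  rw [dotProduct, Fin.sum_univ_three] at hx
  have hI := Complex.I_sq
  obtain ⟨u, hu⟩ := IsAlgClosed.exists_pow_nat_eq ((x 0 + Complex.I * x 1) / 2) two_pos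
  obtain ⟨s, hs⟩ := IsAlgClosed.exists_pow_nat_eq ((Complex.I * x 1 - x 0) / 2) two_pos
  have hsq : (2 * u * s) ^ 2 = x 2 ^ 2 := by
    rw [mul_pow, mul_pow, hu, hs]
    linear_combination hI * x 1 ^ 2 - hx
  obtain ⟨s, hs, hus⟩ : ∃ s' : ℂ, s' ^ 2 = (Complex.I * x 1 - x 0) / 2 ∧ 2 * u * s' = x 2 := by
    rcases sq_eq_sq_iff_eq_or_eq_neg.1 hsq with h | h
    · exact ⟨s, hs, h⟩
    · exact ⟨-s, by rw [neg_sq, hs], by rw [mul_neg, h, neg_neg]⟩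
  refine ⟨![u, s], fun i => ?_⟩
  fin_cases i
  · suffices u ^ 2 - s ^ 2 = x 0 by simpa [conicParam, homogenize_X_pow] using this
    linear_combination hu - hs
  · suffices -(Complex.I * (u ^ 2 + s ^ 2)) = x 1 by
      simpa only [conicParam, Fin.mk_one, Matrix.cons_val, neg_mul, homogenize_neg,
        homogenize_C_mul, homogenize_add, homogenize_X_pow le_rfl, homogenize_one, map_neg, map_mul,
        map_add, map_pow, MvPolynomial.eval_C, MvPolynomial.eval_X, Nat.sub_self, pow_zero,
        mul_one] using this
    linear_combination -Complex.I * (hu + hs) - x 1 * hI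
  · suffices 2 * (u * s) = x 2 by
      simpa [conicParam, ← C_ofNat, homogenize_C_mul, homogenize_X] using this
    linear_combination hus

theorem map_formPoly (T : ℂ[X] →ₗ[ℂ] ℂ) (v : Fin 3 → (Fin 3 → ℝ)) (L : Fin 3 → ℝ) :
    T (formPoly v L) = (fun i => T (conicParam i)) ⬝ᵥ (Complex.ofReal ∘ frameValues v L) := by
  simp only [formPoly_apply, map_sum, dotProduct, Function.comp_apply, ← Complex.coe_smul,
    map_smul, smul_eq_mul, mul_comm]

theorem exists_forall_apply_eq_of_linearCombination {K ι V W : Type*} [Field K] [AddCommGroup V]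
    [Module K V] [AddCommGroup W] [Module K W] {f : ι → V} {g : ι → W}
    (h : ∀ c, Finsupp.linearCombination K f c = 0 → Finsupp.linearCombination K g c = 0) :
    ∃ T : V →ₗ[K] W, ∀ i, T (f i) = g i := by
  set F := Finsupp.linearCombination K f
  obtain ⟨S, hS⟩ := LinearMap.exists_leftInverse_of_injective _
    (Submodule.ker_liftQ_eq_bot (LinearMap.ker F) F le_rfl le_rfl)
  have hker : LinearMap.ker F ≤ LinearMap.ker (Finsupp.linearCombination K g) := h
  refine ⟨(LinearMap.ker F).liftQ _ hker ∘ₗ S, fun i => ?_⟩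
  have hi : S (f i) = Submodule.Quotient.mk (Finsupp.single i 1) := by
    simpa [F] using LinearMap.congr_fun hS (Submodule.Quotient.mk (Finsupp.single i 1))
  rw [LinearMap.comp_apply, hi, Submodule.liftQ_apply, Finsupp.linearCombination_single, one_smul]

namespace IsOrthonormalFrame

variable {v v' : Fin 3 → (Fin 3 → ℝ)} {Q : QuadraticForm ℝ (Fin 3 → ℝ)} {d : ℕ}

theorem exists_eval_formPoly_eq (hv : IsOrthonormalFrame Q v) (hv' : IsOrthonormalFrame Q v')
    (z : ℂ) : ∃ g : Fin 2 → ℂ, ∀ L,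
      (formPoly v' L).eval z = MvPolynomial.eval g ((formPoly v L).homogenize 2) := by
  obtain ⟨R, hR, hL⟩ := hv.exists_orthogonal hv'
  set a : Fin 3 → ℂ := fun i => (conicParam i).eval z
  set S : Matrix (Fin 3) (Fin 3) ℂ := R.map Complex.ofRealHom
  have hS : S * S.transpose = 1 := by
    rw [← Matrix.map_one _ (map_zero Complex.ofRealHom) (map_one _), ← hR, Matrix.map_mul,
      Matrix.transpose_map]
  have ha : a ⬝ᵥ a = 0 := by
    simpa [dotProduct, eval_finsetSum, a] using congrArg (eval z) conicParam_dotProduct_self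
  have hx : Matrix.vecMul a S ⬝ᵥ Matrix.vecMul a S = 0 := by
    rw [← Matrix.dotProduct_mulVec, ← Matrix.mulVec_transpose, Matrix.mulVec_mulVec, hS,
      Matrix.one_mulVec, ha]
  obtain ⟨g, hg⟩ := exists_eval_homogenize_conicParam_eq hx
  refine ⟨g, fun L => ?_⟩
  calc (formPoly v' L).eval z = a ⬝ᵥ (Complex.ofReal ∘ frameValues v' L) :=
        map_formPoly (leval z) v' L
    _ = a ⬝ᵥ Matrix.mulVec S (Complex.ofReal ∘ frameValues v L) := by
        rw [hL]
        exact congrArg _ (funext fun i => RingHom.map_mulVec Complex.ofRealHom R _ i)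
    _ = Matrix.vecMul a S ⬝ᵥ (Complex.ofReal ∘ frameValues v L) := Matrix.dotProduct_mulVec _ _ _
    _ = MvPolynomial.eval g ((formPoly v L).homogenize 2) := by
        rw [← funext hg]
        exact (map_formPoly ((MvPolynomial.aeval g).toLinearMap ∘ₗ homogenizeLM 2) v L).symm

theorem exists_eval_multipolePoly_eq (hv : IsOrthonormalFrame Q v)
    (hv' : IsOrthonormalFrame Q v') (z : ℂ) :
    ∃ T : ℂ[X] →ₗ[ℝ] ℂ, ∀ L : Fin d → LinForm,
      (multipolePoly v' L).eval z = T (multipolePoly v L) := by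
  obtain ⟨g, hg⟩ := hv.exists_eval_formPoly_eq hv' z
  refine ⟨((MvPolynomial.aeval g).toLinearMap ∘ₗ
    homogenizeLM (∑ _ : Fin d, 2)).restrictScalars ℝ, fun L => ?_⟩
  change _ = MvPolynomial.eval g ((multipolePoly v L).homogenize _)
  rw [multipolePoly, multipolePoly, homogenize_finsetProd fun j _ =>
    ((formPoly_mem_antipodalReal v (L j).1).1), eval_prod, map_prod]
  exact Finset.prod_congr rfl fun j _ => hg _

theorem exists_multipoleMap_eq_comp (hv : IsOrthonormalFrame Q v)
    (hv' : IsOrthonormalFrame Q v') (d : ℕ) :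
    ∃ T : ((Fin d → ℂ) × ℝ) →L[ℝ] (Fin d → ℂ) × ℝ,
      ∀ m, multipoleMap v' d m = T (multipoleMap v d m) := by
  suffices h : ∀ c : (Fin d → LinForm) →₀ ℝ,
      Finsupp.linearCombination ℝ (antipodalCoeffs d ∘ multipolePoly v) c = 0 →
      Finsupp.linearCombination ℝ (antipodalCoeffs d ∘ multipolePoly v') c = 0 by
    obtain ⟨T, hT⟩ := exists_forall_apply_eq_of_linearCombination h
    refine ⟨LinearMap.toContinuousLinearMap T, fun m => ?_⟩
    obtain ⟨L, rfl⟩ := m.exists_rep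
    exact (hT L).symm
  intro c hc
  rw [← Finsupp.apply_linearCombination] at hc ⊢
  have hmem : Finsupp.linearCombination ℝ (multipolePoly v) c ∈ antipodalReal d :=
    Submodule.finsuppSum_mem _ _ c _ fun L _ =>
      Submodule.smul_mem _ _ (multipolePoly_mem_antipodalReal v L)
  have hzero := eq_zero_of_antipodalCoeffs_eq_zero hmem hc
  convert map_zero (antipodalCoeffs d)
  refine Polynomial.funext fun z => ?_
  obtain ⟨T, hT⟩ := hv.exists_eval_multipolePoly_eq (d := d) hv' z
  calc (Finsupp.linearCombination ℝ (multipolePoly v') c).eval z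
      = Finsupp.linearCombination ℝ (fun L => (multipolePoly v' L).eval z) c :=
        Finsupp.apply_linearCombination ℝ ((leval z).restrictScalars ℝ) _ c
    _ = T (Finsupp.linearCombination ℝ (multipolePoly v) c) := by
        rw [funext hT]
        exact (Finsupp.apply_linearCombination ℝ T _ c).symm
    _ = eval z 0 := by rw [hzero, map_zero, eval_zero]

theorem multipoleMap_injective (hQ : Q.PosDef) (hv : IsOrthonormalFrame Q v) :
    Function.Injective (multipoleMap v d) := by
  intro m n h
  obtain ⟨L, rfl⟩ := m.exists_rep
  obtain ⟨M, rfl⟩ := n.exists_rep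
  obtain ⟨v', hv', hLM⟩ := exists_isOrthonormalFrame hQ (Sum.elim L M)
  obtain ⟨T, hT⟩ := hv.exists_multipoleMap_eq_comp hv' d
  exact hv'.injOn_multipoleMap ⟨L, rfl, fun j => hLM (.inl j)⟩ ⟨M, rfl, fun j => hLM (.inr j)⟩
    (by rw [hT, hT, h])

theorem range_multipoleMap [NeZero d] (hv : IsOrthonormalFrame Q v) :
    Set.range (multipoleMap v d) = {0}ᶜ := by
  refine Set.Subset.antisymm (Set.range_subset_iff.2 hv.multipoleMap_ne_zero) fun h h0 => ?_
  obtain ⟨P, hP, rfl⟩ := exists_mem_antipodalReal_antipodalCoeffs_eq h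
  obtain ⟨c, hc, w, rfl⟩ := exists_eq_smul_prod_antipodalPair hP
    fun hP0 => h0 (by rw [hP0, map_zero]; rfl)
  obtain ⟨L, hL, -⟩ := hv.exists_multipolePoly_eq hc w
  exact ⟨.mk L, by rw [multipoleMap_mk, hL]⟩

theorem mem_chartDomain_iff [NeZero d] (hQ : Q.PosDef) (hv : IsOrthonormalFrame Q v)
    {m : MultipoleSpace d} :
    m ∈ MultipoleSpace.chartDomain v d ↔ multipoleMap v d m ∈ (conicMapHomeo d).target := by
  rw [← (conicMapHomeo d).image_source_eq_target]
  refine ⟨fun hm => ⟨_, MultipoleSpace.mapsTo_chartCoord v d hm,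
    (eqOn_multipoleMap_conicMap v d hm).symm⟩, ?_⟩
  rintro ⟨⟨a, t⟩, ⟨ha, ht⟩, hat⟩
  obtain ⟨w, rfl⟩ := exists_rootCoeffs_eq a
  obtain ⟨L, hL, hL2⟩ := hv.exists_multipolePoly_eq ht w
  refine ⟨L, hv.multipoleMap_injective hQ ?_, fun j h => ?_⟩
  · rw [← hat, multipoleMap_mk, hL, coe_conicMapHomeo, conicMap_rootCoeffs]
  · exact (pow_lt_one₀ (norm_nonneg _) (rootCoeffs_mem_discRootSet.1 ha j) two_ne_zero).ne
      ((hL2 j).1 h)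

end IsOrthonormalFrame

/-! ### Topology of the multipole spaces -/

section Topology

open Topology

theorem continuous_coeff_prod {X ι R : Type*} [TopologicalSpace X] [CommSemiring R]
    [TopologicalSpace R] [IsTopologicalSemiring R] (s : Finset ι) {f : ι → X → R[X]}
    (hf : ∀ i k, Continuous fun x => (f i x).coeff k) (k : ℕ) :
    Continuous fun x => (∏ i ∈ s, f i x).coeff k := by
  induction s using Finset.cons_induction generalizing k with
  | empty => simpa using continuous_const
  | cons i s hi ih =>
    simp only [Finset.prod_cons, coeff_mul]
    exact continuous_finsetSum _ fun kl _ => (hf i _).mul (ih _)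

theorem isProperMap_snd_smul_of_forall_ne_zero {X 𝕜 E : Type*} [TopologicalSpace X]
    [CompactSpace X] [NormedField 𝕜] [ProperSpace 𝕜] [NormedAddCommGroup E] [NormedSpace 𝕜 E]
    {f : X → E} (hf : Continuous f) (h0 : ∀ x, f x ≠ 0) :
    IsProperMap fun p : X × 𝕜 => p.2 • f p.1 := by
  have hcont : Continuous fun p : X × 𝕜 => p.2 • f p.1 :=
    continuous_snd.smul (hf.comp continuous_fst)
  refine isProperMap_iff_isCompact_preimage.2 ⟨hcont, fun K hK => ?_⟩
  obtain ⟨δ, hδ, hle⟩ := isCompact_univ.exists_forall_le' hf.norm.continuousOn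
    fun x _ => norm_pos_iff.2 (h0 x)
  obtain ⟨r, hr⟩ := hK.isBounded.exists_norm_le
  refine (isCompact_univ.prod (isCompact_closedBall (0 : 𝕜) (r / δ))).of_isClosed_subset
    (hK.isClosed.preimage hcont) fun p hp => ⟨trivial, ?_⟩
  rw [mem_closedBall_zero_iff, le_div_iff₀ hδ]
  calc ‖p.2‖ * δ ≤ ‖p.2‖ * ‖f p.1‖ := mul_le_mul_of_nonneg_left (hle p.1 trivial) (norm_nonneg _)
    _ = ‖p.2 • f p.1‖ := (norm_smul _ _).symm
    _ ≤ r := hr _ hp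

variable {v : Fin 3 → (Fin 3 → ℝ)} {Q : QuadraticForm ℝ (Fin 3 → ℝ)} {d : ℕ}

theorem LinForm.continuous_scale : Continuous fun p : ℝˣ × LinForm => LinForm.scale p.1 p.2 :=
  ((Units.continuous_val.comp continuous_fst).smul
    (continuous_subtype_val.comp continuous_snd)).subtype_mk _

theorem continuous_coeff_formPoly (v : Fin 3 → (Fin 3 → ℝ)) (k : ℕ) :
    Continuous fun L => (formPoly v L).coeff k :=
  ((lcoeff ℂ k).restrictScalars ℝ ∘ₗ formPoly v).continuous_of_finiteDimensional

theorem MultipoleSpace.isQuotientMap_mk : IsQuotientMap (mk (d := d)) :=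
  isQuotientMap_quot_mk

theorem continuous_multipoleMap (v : Fin 3 → (Fin 3 → ℝ)) (d : ℕ) :
    Continuous (multipoleMap v d) := by
  have hcoeff (k : ℕ) : Continuous fun L : Fin d → LinForm => (multipolePoly v L).coeff k :=
    continuous_coeff_prod _ (fun j k => (continuous_coeff_formPoly v k).comp
      (continuous_subtype_val.comp (continuous_apply j))) k
  exact MultipoleSpace.isQuotientMap_mk.continuous_iff.2
    ((continuous_pi fun k : Fin d => hcoeff k).prodMk (Complex.continuous_re.comp (hcoeff d)))

/-- A unit vector, viewed as a linear form. -/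
def unitForm (x : Metric.sphere (0 : Fin 3 → ℝ) 1) : LinForm :=
  ⟨x.1, ne_zero_of_mem_unit_sphere x⟩

theorem exists_scale_unitForm_eq (L : LinForm) : ∃ x t, LinForm.scale t (unitForm x) = L := by
  have hL : ‖L.1‖ ≠ 0 := norm_ne_zero_iff.2 L.2
  refine ⟨⟨‖L.1‖⁻¹ • L.1, ?_⟩, Units.mk0 ‖L.1‖ hL, Subtype.ext ?_⟩
  · rw [mem_sphere_zero_iff_norm, norm_smul, norm_inv, norm_norm, inv_mul_cancel₀ hL]
  · simp [LinForm.scale, unitForm, smul_smul, mul_inv_cancel₀ hL]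

theorem continuous_unitForm_comp :
    Continuous fun (x : Fin d → Metric.sphere (0 : Fin 3 → ℝ) 1) j => unitForm (x j) :=
  continuous_pi fun j => (continuous_subtype_val.subtype_mk _).comp (continuous_apply j)

/-- The product of a scalar with the restriction to the conic of a product of unit forms. Its
source, unlike a product of spaces of forms, makes it a proper map. -/
def coneMap (v : Fin 3 → (Fin 3 → ℝ)) (d : ℕ)
    (p : (Fin d → Metric.sphere (0 : Fin 3 → ℝ) 1) × ℝ) : (Fin d → ℂ) × ℝ :=
  p.2 • multipoleMap v d (.mk fun j => unitForm (p.1 j))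

theorem IsOrthonormalFrame.isProperMap_coneMap (hv : IsOrthonormalFrame Q v) :
    IsProperMap (coneMap v d) :=
  isProperMap_snd_smul_of_forall_ne_zero ((continuous_multipoleMap v d).comp
    (MultipoleSpace.isQuotientMap_mk.continuous.comp continuous_unitForm_comp))
    fun _ => hv.multipoleMap_ne_zero _

theorem IsOrthonormalFrame.coneMap_surjective [NeZero d] (hv : IsOrthonormalFrame Q v) :
    Function.Surjective (coneMap v d) := by
  intro h
  rcases eq_or_ne h 0 with rfl | h0
  · obtain ⟨x, -⟩ := exists_scale_unitForm_eq ⟨1, one_ne_zero⟩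
    exact ⟨(fun _ => x, 0), zero_smul _ _⟩
  · obtain ⟨m, rfl⟩ : h ∈ Set.range (multipoleMap v d) := hv.range_multipoleMap.ge h0
    obtain ⟨L, rfl⟩ := m.exists_rep
    choose x t hx using fun j => exists_scale_unitForm_eq (L j)
    refine ⟨(x, ((∏ j, t j : ℝˣ) : ℝ)), ?_⟩
    rw [coneMap, ← multipoleMap_mk_scale, funext hx]

theorem IsOrthonormalFrame.isQuotientMap_coneMap [NeZero d] (hv : IsOrthonormalFrame Q v) :
    IsQuotientMap (coneMap v d) :=
  hv.isProperMap_coneMap.isClosedMap.isQuotientMap hv.isProperMap_coneMap.continuous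
    hv.coneMap_surjective

theorem IsOrthonormalFrame.isOpenEmbedding_multipoleMap [NeZero d] (hQ : Q.PosDef)
    (hv : IsOrthonormalFrame Q v) : IsOpenEmbedding (multipoleMap v d) := by
  let f : MultipoleSpace d → ({0}ᶜ : Set ((Fin d → ℂ) × ℝ)) :=
    fun m => ⟨multipoleMap v d m, hv.multipoleMap_ne_zero m⟩
  have hne (p : coneMap v d ⁻¹' {0}ᶜ) : p.1.2 ≠ 0 := fun h => p.2 (by simp [coneMap, h])
  let t (p : coneMap v d ⁻¹' {0}ᶜ) : ℝˣ := Units.mk0 p.1.2 (hne p)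
  have ht : Continuous t := Units.isEmbedding_val₀.continuous_iff.2
    (continuous_snd.comp continuous_subtype_val)
  let g (p : coneMap v d ⁻¹' {0}ᶜ) : MultipoleSpace d :=
    .mk fun j => LinForm.scale ((Pi.mulSingle 0 (t p) : Fin d → ℝˣ) j) (unitForm (p.1.1 j))
  have hg : Continuous g := by
    refine MultipoleSpace.isQuotientMap_mk.continuous.comp (continuous_pi fun j =>
      LinForm.continuous_scale.comp (.prodMk ?_ ?_))
    · exact (continuous_apply j).comp ((continuous_mulSingle 0).comp ht)
    · exact (continuous_apply j).comp (continuous_unitForm_comp.comp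
        (continuous_fst.comp continuous_subtype_val))
  have hfg : f ∘ g = ({0}ᶜ : Set ((Fin d → ℂ) × ℝ)).restrictPreimage (coneMap v d) := by
    funext p
    apply Subtype.ext
    change multipoleMap v d (.mk _) = coneMap v d p.1
    rw [multipoleMap_mk_scale, Fintype.prod_pi_mulSingle']
    rfl
  have hfc : Continuous f := (continuous_multipoleMap v d).subtype_mk _
  have hfq : IsQuotientMap f := .of_comp hg hfc
    (hfg ▸ hv.isQuotientMap_coneMap.restrictPreimage_isOpen isOpen_compl_singleton)
  have hfi : Function.Injective f :=
    fun m n h => hv.multipoleMap_injective hQ (congrArg Subtype.val h)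
  exact isOpen_compl_singleton.isOpenEmbedding_subtypeVal.comp
    (isHomeomorph_iff_isQuotientMap_injective.2 ⟨hfq, hfi⟩).isOpenEmbedding

/-- The map from the coned multipole space to coordinates of antipodally real polynomials which
extends the multipole map linearly along the fibres of the line bundle. -/
def conedMap (v : Fin 3 → (Fin 3 → ℝ)) (d : ℕ) : ConedMultipoleSpace d → (Fin d → ℂ) × ℝ :=
  Quotient.lift
    (Quotient.lift (fun p : MultipoleSpace d × ℝ => p.2 • multipoleMap v d p.1) (by
      rintro ⟨m, s⟩ ⟨n, t⟩ ⟨L, c, rfl : m = _, rfl : n = _, rfl : s = _⟩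
      rw [multipoleMap_mk_scale, smul_smul, mul_comm])) (by
    rintro x y (rfl | ⟨⟨m, rfl⟩, ⟨n, rfl⟩⟩)
    · rfl
    · exact (zero_smul _ _).trans (zero_smul _ _).symm)

/-- The point of the coned multipole space represented by a multipole and a scalar. -/
def conedMk {d : ℕ} (p : MultipoleSpace d × ℝ) : ConedMultipoleSpace d :=
  Quotient.mk (conedSetoid d) (Quotient.mk (multipoleLineSetoid d) p)

theorem isQuotientMap_conedMk : IsQuotientMap (conedMk (d := d)) :=
  isQuotientMap_quot_mk.comp isQuotientMap_quot_mk

theorem conedMap_conedMk (v : Fin 3 → (Fin 3 → ℝ)) (m : MultipoleSpace d) (s : ℝ) :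
    conedMap v d (conedMk (m, s)) = s • multipoleMap v d m := rfl

theorem continuous_conedMap (v : Fin 3 → (Fin 3 → ℝ)) (d : ℕ) : Continuous (conedMap v d) :=
  isQuotientMap_conedMk.continuous_iff.2
    (continuous_snd.smul ((continuous_multipoleMap v d).comp continuous_fst))

theorem exists_conedMk_one_eq [NeZero d] (m : MultipoleSpace d) {s : ℝ} (hs : s ≠ 0) :
    ∃ n, conedMk (n, 1) = conedMk (m, s) := by
  obtain ⟨L, rfl⟩ := m.exists_rep
  refine ⟨.mk fun j => LinForm.scale ((Pi.mulSingle 0 (Units.mk0 s hs) : Fin d → ℝˣ) j) (L j),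
    congrArg (Quotient.mk (conedSetoid d)) (Eq.symm (Quotient.sound ⟨L, _, rfl, rfl, ?_⟩))⟩
  rw [Fintype.prod_pi_mulSingle', Units.val_mk0, mul_one]

theorem IsOrthonormalFrame.conedMap_injective [NeZero d] (hQ : Q.PosDef)
    (hv : IsOrthonormalFrame Q v) : Function.Injective (conedMap v d) := by
  intro x y h
  obtain ⟨⟨m, s⟩, rfl⟩ := isQuotientMap_conedMk.surjective x
  obtain ⟨⟨n, t⟩, rfl⟩ := isQuotientMap_conedMk.surjective y
  rcases eq_or_ne s 0 with rfl | hs <;> rcases eq_or_ne t 0 with rfl | ht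
  · exact Quotient.sound (Or.inr ⟨⟨m, rfl⟩, ⟨n, rfl⟩⟩)
  · rw [conedMap_conedMk, conedMap_conedMk, zero_smul] at h
    exact absurd h.symm (smul_ne_zero ht (hv.multipoleMap_ne_zero n))
  · rw [conedMap_conedMk, conedMap_conedMk, zero_smul] at h
    exact absurd h (smul_ne_zero hs (hv.multipoleMap_ne_zero m))
  · obtain ⟨m', hm⟩ := exists_conedMk_one_eq m hs
    obtain ⟨n', hn⟩ := exists_conedMk_one_eq n ht
    rw [← hm, ← hn, conedMap_conedMk, conedMap_conedMk, one_smul, one_smul] at h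
    rw [← hm, ← hn, hv.multipoleMap_injective hQ h]

theorem IsOrthonormalFrame.isHomeomorph_conedMap [NeZero d] (hQ : Q.PosDef)
    (hv : IsOrthonormalFrame Q v) : IsHomeomorph (conedMap v d) := by
  have hlift : Continuous fun p : (Fin d → Metric.sphere (0 : Fin 3 → ℝ) 1) × ℝ =>
      conedMk (.mk fun j => unitForm (p.1 j), p.2) :=
    isQuotientMap_conedMk.continuous.comp ((MultipoleSpace.isQuotientMap_mk.continuous.comp
      (continuous_unitForm_comp.comp continuous_fst)).prodMk continuous_snd)
  exact isHomeomorph_iff_isQuotientMap_injective.2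
    ⟨.of_comp hlift (continuous_conedMap v d) hv.isQuotientMap_coneMap, hv.conedMap_injective hQ⟩

end Topology

/-! ### Smooth structures transported by a chart-wise smooth homeomorphism -/

section ChartwiseSmooth

variable {𝕜 E E' H' M N : Type*} [NontriviallyNormedField 𝕜] [NormedAddCommGroup E]
  [NormedSpace 𝕜 E] [TopologicalSpace M] [ChartedSpace E M] [NormedAddCommGroup E']
  [NormedSpace 𝕜 E'] [TopologicalSpace H'] {J : ModelWithCorners 𝕜 E' H'} [TopologicalSpace N]
  [ChartedSpace H' N] {n : WithTop ℕ∞}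

theorem isManifold_of_forall_contMDiffOn {f : OpenPartialHomeomorph M N} (hf : f.source = .univ)
    (h : ∀ e ∈ atlas E M, ContMDiffOn 𝓘(𝕜, E) J n (f ∘ e.symm) e.target)
    (h' : ∀ e ∈ atlas E M,
      ContMDiffOn J 𝓘(𝕜, E) n (e ∘ f.symm) (f.target ∩ f.symm ⁻¹' e.source)) :
    IsManifold 𝓘(𝕜, E) n M := by
  refine isManifold_of_contDiffOn _ _ _ fun e e' he he' => ?_
  simp only [modelWithCornersSelf_coe, modelWithCornersSelf_coe_symm, Function.comp_id,
    Function.id_comp, Set.range_id, Set.preimage_id, Set.inter_univ]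
  have hleft (x : M) : f.symm (f x) = x := f.left_inv (hf ▸ trivial)
  have hcomp : ContMDiffOn 𝓘(𝕜, E) 𝓘(𝕜, E) n ((e' ∘ f.symm) ∘ f ∘ e.symm)
      (e.symm ≫ₕ e').source :=
    (h' e' he').comp ((h e he).mono fun x hx => hx.1) fun x hx =>
      ⟨f.map_source (hf ▸ trivial), (congrArg (· ∈ e'.source) (hleft _)).mpr hx.2⟩
  exact hcomp.contDiffOn.congr fun x _ => congrArg e' (hleft _).symm

theorem contMDiff_of_forall_contMDiffOn_comp_symm [IsManifold 𝓘(𝕜, E) n M] {f : M → N}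
    (h : ∀ e ∈ atlas E M, ContMDiffOn 𝓘(𝕜, E) J n (f ∘ e.symm) e.target) :
    ContMDiff 𝓘(𝕜, E) J n f := fun x => by
  have hx := (chartAt E x).open_source.mem_nhds (mem_chart_source E x)
  have hcomp : ContMDiffOn 𝓘(𝕜, E) J n ((f ∘ (chartAt E x).symm) ∘ chartAt E x)
      (chartAt E x).source :=
    (h _ (chart_mem_atlas E x)).comp contMDiffOn_chart (chartAt E x).mapsTo
  exact (hcomp.congr fun y hy => congrArg f ((chartAt E x).left_inv hy).symm).contMDiffAt hx

theorem contMDiffOn_of_forall_contMDiffOn_chart_comp {g : N → M} {s : Set N}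
    (hg : ContinuousOn g s)
    (h : ∀ e ∈ atlas E M, ContMDiffOn J 𝓘(𝕜, E) n (e ∘ g) (s ∩ g ⁻¹' e.source)) :
    ContMDiffOn J 𝓘(𝕜, E) n g s :=
  fun x hx => by
  have hU := (chartAt E (g x)).open_source.mem_nhds (mem_chart_source E (g x))
  refine contMDiffWithinAt_iff_target.2 ⟨hg x hx, ?_⟩
  refine ContMDiffWithinAt.mono_of_mem_nhdsWithin ?_
    (Filter.inter_mem self_mem_nhdsWithin (hg x hx hU))
  simpa using h _ (chart_mem_atlas E (g x)) x ⟨hx, mem_chart_source E (g x)⟩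

end ChartwiseSmooth

/-! ### The smooth structure of real projective space -/

section Projective

open Topology

theorem isOpenQuotientMap_projectivization_mk (V : Type*) [AddCommGroup V] [Module ℝ V]
    [TopologicalSpace V] [ContinuousConstSMul ℝ V] :
    IsOpenQuotientMap fun x : {x : V // x ≠ 0} => Projectivization.mk ℝ x.1 x.2 := by
  have hq : IsQuotientMap fun x : {x : V // x ≠ 0} => Projectivization.mk ℝ x.1 x.2 :=
    isQuotientMap_quot_mk
  refine ⟨hq.surjective, hq.continuous, fun U hU => ?_⟩
  let f (t : ℝˣ) (x : {x : V // x ≠ 0}) : {x : V // x ≠ 0} :=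
    ⟨(t : ℝ) • x.1, smul_ne_zero t.ne_zero x.2⟩
  have hsat : (fun x : {x : V // x ≠ 0} => Projectivization.mk ℝ x.1 x.2) ⁻¹'
      ((fun x : {x : V // x ≠ 0} => Projectivization.mk ℝ x.1 x.2) '' U) = ⋃ t, f t ⁻¹' U := by
    ext x
    simp only [Set.mem_preimage, Set.mem_image, Set.mem_iUnion]
    constructor
    · rintro ⟨y, hy, h⟩
      obtain ⟨t, ht⟩ := (Projectivization.mk_eq_mk_iff ℝ _ _ _ _).1 h
      exact ⟨t, by rwa [show f t x = y from Subtype.ext ht]⟩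
    · rintro ⟨t, ht⟩
      exact ⟨_, ht, (Projectivization.mk_eq_mk_iff ℝ _ _ _ _).2 ⟨t, rfl⟩⟩
  rw [← hq.isOpen_preimage, hsat]
  exact isOpen_iUnion fun t => hU.preimage
    ((continuous_subtype_val.const_smul (t : ℝ)).subtype_mk _)

namespace RealProj

variable {n : ℕ}

theorem mk_mem_affineDomain_iff {i : Fin (n + 1)} {x : Fin (n + 1) → ℝ} (hx : x ≠ 0) :
    Projectivization.mk ℝ x hx ∈ affineDomain i ↔ x i ≠ 0 := by
  obtain ⟨t, ht⟩ := Projectivization.exists_smul_eq_mk_rep ℝ x hx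
  change (Projectivization.mk ℝ x hx).rep i ≠ 0 ↔ _
  rw [← ht]
  simp [Units.smul_def]

theorem exists_mem_affineDomain (p : RealProj n) : ∃ i, p ∈ affineDomain i :=
  Function.ne_iff.1 p.rep_nonzero

theorem isOpen_affineDomain (i : Fin (n + 1)) : IsOpen (affineDomain i) := by
  rw [← (isOpenQuotientMap_projectivization_mk _).isQuotientMap.isOpen_preimage]
  simp only [Set.preimage, mk_mem_affineDomain_iff]
  exact isOpen_compl_singleton.preimage ((continuous_apply i).comp continuous_subtype_val)

theorem affineCoord_mk (i : Fin (n + 1)) {x : Fin (n + 1) → ℝ} (hx : x ≠ 0) :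
    affineCoord i (Projectivization.mk ℝ x hx) = fun j => x (i.succAbove j) / x i := rfl

theorem contDiffOn_succAbove_div {k : WithTop ℕ∞} (i : Fin (n + 1)) :
    ContDiffOn ℝ k (fun (x : Fin (n + 1) → ℝ) (j : Fin n) => x (i.succAbove j) / x i)
      {x | x i ≠ 0} :=
  contDiffOn_pi.2 fun j =>
    (contDiff_apply ℝ ℝ (i.succAbove j)).contDiffOn.div (contDiff_apply ℝ ℝ i).contDiffOn
      fun _ hx => hx

/-- The homogeneous coordinates with `i`-th entry `1` of a point in affine coordinates. -/
def homogCoord (i : Fin (n + 1)) (y : Fin n → ℝ) : Fin (n + 1) → ℝ :=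
  Fin.insertNth (α := fun _ => ℝ) i 1 y

@[simp]
theorem homogCoord_same (i : Fin (n + 1)) (y : Fin n → ℝ) : homogCoord i y i = 1 :=
  Fin.insertNth_apply_same i _ _

@[simp]
theorem homogCoord_succAbove (i : Fin (n + 1)) (y : Fin n → ℝ) (j : Fin n) :
    homogCoord i y (i.succAbove j) = y j :=
  Fin.insertNth_apply_succAbove i _ _ j

theorem homogCoord_ne_zero (i : Fin (n + 1)) (y : Fin n → ℝ) : homogCoord i y ≠ 0 :=
  fun h => by simpa using congrFun h i

theorem contDiff_homogCoord {k : WithTop ℕ∞} (i : Fin (n + 1)) :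
    ContDiff ℝ k (homogCoord i) := by
  refine contDiff_pi.2 fun l => ?_
  rcases Fin.eq_self_or_eq_succAbove i l with rfl | ⟨j, rfl⟩
  · simpa using contDiff_const
  · simpa using contDiff_apply ℝ ℝ j

theorem mk_homogCoord_affineCoord {i : Fin (n + 1)} {p : RealProj n} (hp : p ∈ affineDomain i) :
    Projectivization.mk ℝ (homogCoord i (affineCoord i p)) (homogCoord_ne_zero i _)
      = p := by
  induction p using Projectivization.ind with
  | h x hx =>
    have hi : x i ≠ 0 := (mk_mem_affineDomain_iff hx).1 hp
    refine (Projectivization.mk_eq_mk_iff' ℝ _ _ _ _).2 ⟨(x i)⁻¹, funext fun k => ?_⟩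
    rcases Fin.eq_self_or_eq_succAbove i k with rfl | ⟨j, rfl⟩
    · simp [hi]
    · simp [affineCoord_mk, div_eq_inv_mul]

/-- The affine chart of `ℝPⁿ` with index `i`. -/
def affineChart (i : Fin (n + 1)) : OpenPartialHomeomorph (RealProj n) (Fin n → ℝ) where
  toFun := affineCoord i
  invFun y := Projectivization.mk ℝ (homogCoord i y) (homogCoord_ne_zero i y)
  source := affineDomain i
  target := Set.univ
  map_source' _ _ := trivial
  map_target' y _ := (mk_mem_affineDomain_iff _).2 (by simp)
  left_inv' _ hp := mk_homogCoord_affineCoord hp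
  right_inv' y _ := by simp [affineCoord_mk]
  open_source := isOpen_affineDomain i
  open_target := isOpen_univ
  continuousOn_toFun := by
    rw [(isOpenQuotientMap_projectivization_mk _).isQuotientMap.continuousOn_isOpen_iff
      (isOpen_affineDomain i)]
    exact (contDiffOn_succAbove_div (k := 0) i).continuousOn.comp
      continuous_subtype_val.continuousOn fun x hx => (mk_mem_affineDomain_iff x.2).1 hx
  continuousOn_invFun :=
    ((isOpenQuotientMap_projectivization_mk _).continuous.comp
      ((contDiff_homogCoord (k := 0) i).continuous.subtype_mk (homogCoord_ne_zero i))).continuousOn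

/-- `ℝPⁿ` with the standard atlas. -/
@[reducible]
def stdChartedSpace (n : ℕ) : ChartedSpace (Fin n → ℝ) (RealProj n) where
  atlas := stdAtlas n
  chartAt p := affineChart (exists_mem_affineDomain p).choose
  mem_chart_source p := (exists_mem_affineDomain p).choose_spec
  chart_mem_atlas _ := ⟨_, rfl, fun _ _ => rfl⟩

section Smooth

variable {k : WithTop ℕ∞} {E H M : Type*} [NormedAddCommGroup E] [NormedSpace ℝ E]
  [TopologicalSpace H] {I : ModelWithCorners ℝ E H} [TopologicalSpace M] [ChartedSpace H M]

theorem contMDiffOn_comp_of_mem_stdAtlas {φ : OpenPartialHomeomorph (RealProj n) (Fin n → ℝ)}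
    (hφ : φ ∈ stdAtlas n) {p : M → RealProj n} {G : M → Fin (n + 1) → ℝ} {s : Set M}
    (hG : ContMDiffOn I 𝓘(ℝ, Fin (n + 1) → ℝ) k G s)
    (hp : ∀ a ∈ s, ∃ h0 : G a ≠ 0, p a = Projectivization.mk ℝ (G a) h0)
    (hs : Set.MapsTo p s φ.source) : ContMDiffOn I 𝓘(ℝ, Fin n → ℝ) k (φ ∘ p) s := by
  obtain ⟨i, hsource, hcoe⟩ := hφ
  have hi : Set.MapsTo G s {x | x i ≠ 0} := fun a ha => by
    obtain ⟨h0, hpa⟩ := hp a ha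
    exact (mk_mem_affineDomain_iff h0).1 (hpa ▸ hsource ▸ hs ha)
  refine ((contDiffOn_succAbove_div i).contMDiffOn.comp hG hi).congr fun a ha => ?_
  obtain ⟨h0, hpa⟩ := hp a ha
  rw [Function.comp_apply, hcoe (hs ha), hpa, affineCoord_mk]
  rfl

theorem symm_apply_of_mem_stdAtlas {φ : OpenPartialHomeomorph (RealProj n) (Fin n → ℝ)}
    (hφ : φ ∈ stdAtlas n) : ∃ i : Fin (n + 1), ∀ y ∈ φ.target,
      φ.symm y = Projectivization.mk ℝ (homogCoord i y) (homogCoord_ne_zero i y) := by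
  obtain ⟨i, hsource, hcoe⟩ := hφ
  refine ⟨i, fun y hy => ?_⟩
  have hcoord : affineCoord i (φ.symm y) = y := by rw [← hcoe (φ.map_target hy), φ.right_inv hy]
  have hrecover := mk_homogCoord_affineCoord (hsource ▸ φ.map_target hy)
  simp only [hcoord] at hrecover
  exact hrecover.symm

variable [ChartedSpace (Fin n → ℝ) (RealProj n)]
  (hatlas : atlas (Fin n → ℝ) (RealProj n) ⊆ stdAtlas n)

include hatlas

theorem isManifold_of_atlas_subset : IsManifold 𝓘(ℝ, Fin n → ℝ) k (RealProj n) := by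
  refine isManifold_of_contDiffOn _ _ _ fun φ ψ hφ hψ => ?_
  simp only [modelWithCornersSelf_coe, modelWithCornersSelf_coe_symm, Function.comp_id,
    Function.id_comp, Set.range_id, Set.preimage_id, Set.inter_univ]
  obtain ⟨i, hi⟩ := symm_apply_of_mem_stdAtlas (hatlas hφ)
  exact (contMDiffOn_comp_of_mem_stdAtlas (hatlas hψ)
    (contDiff_homogCoord i).contDiffOn.contMDiffOn
    (fun y hy => ⟨homogCoord_ne_zero i y, hi y hy.1⟩) fun _ hy => hy.2).contDiffOn

theorem contMDiffOn_of_eq_mk {p : M → RealProj n} {G : M → Fin (n + 1) → ℝ} {s : Set M}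
    (hG : ContMDiffOn I 𝓘(ℝ, Fin (n + 1) → ℝ) k G s)
    (hp : ∀ a ∈ s, ∃ h0 : G a ≠ 0, p a = Projectivization.mk ℝ (G a) h0) :
    ContMDiffOn I 𝓘(ℝ, Fin n → ℝ) k p s := by
  refine contMDiffOn_of_forall_contMDiffOn_chart_comp ?_ fun φ hφ =>
    contMDiffOn_comp_of_mem_stdAtlas (hatlas hφ) (hG.mono Set.inter_subset_left)
      (fun a ha => hp a ha.1) fun _ ha => ha.2
  rw [continuousOn_iff_continuous_domRestrict]
  choose h0 hpG using hp
  have hcont : Continuous fun a : s => (⟨G a, h0 a a.2⟩ : {x : Fin (n + 1) → ℝ // x ≠ 0}) :=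
    (continuousOn_iff_continuous_domRestrict.1 hG.continuousOn).subtype_mk _
  exact ((isOpenQuotientMap_projectivization_mk _).continuous.comp hcont).congr
    fun a => (hpG a a.2).symm

theorem contMDiffOn_of_comp_mk {g : RealProj n → M} {G : (Fin (n + 1) → ℝ) → M}
    {U : Set (RealProj n)} {V : Set (Fin (n + 1) → ℝ)}
    (hG : ContMDiffOn 𝓘(ℝ, Fin (n + 1) → ℝ) I k G V)
    (hg : ∀ x hx, Projectivization.mk ℝ x hx ∈ U →
      x ∈ V ∧ g (Projectivization.mk ℝ x hx) = G x) :
    ContMDiffOn 𝓘(ℝ, Fin n → ℝ) I k g U := fun p hp => by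
  have := isManifold_of_atlas_subset (k := k) hatlas
  set φ := chartAt (Fin n → ℝ) p
  obtain ⟨i, hi⟩ := symm_apply_of_mem_stdAtlas (hatlas (chart_mem_atlas _ p))
  have hlift (q) (hq : q ∈ U ∩ φ.source) :
      homogCoord i (φ q) ∈ V ∧ g q = G (homogCoord i (φ q)) := by
    have hmk := hi (φ q) (φ.map_source hq.2)
    rw [φ.left_inv hq.2] at hmk
    simpa only [← hmk] using hg _ (homogCoord_ne_zero i (φ q)) (hmk ▸ hq.1)
  have hcomp : ContMDiffOn 𝓘(ℝ, Fin n → ℝ) I k g (U ∩ φ.source) :=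
    (hG.comp ((contDiff_homogCoord i).contMDiff.comp_contMDiffOn
      (contMDiffOn_chart.mono Set.inter_subset_right)) fun q hq => (hlift q hq).1).congr
      fun q hq => (hlift q hq).2
  exact (hcomp p ⟨hp, mem_chart_source _ p⟩).mono_of_mem_nhdsWithin
    (Filter.inter_mem self_mem_nhdsWithin
      (mem_nhdsWithin_of_mem_nhds (φ.open_source.mem_nhds (mem_chart_source _ p))))

end Smooth

end RealProj

end Projective

/-! ### The smooth structure of the multipole space -/

section Polar

variable {E : Type*} [NormedAddCommGroup E] [InnerProductSpace ℝ E] {n : ℕ}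
  [Fact (Module.finrank ℝ E = n + 1)]

/-- Polar coordinates `x ↦ (x / ‖x‖, log ‖x‖)` on the complement of the origin. -/
def polarDiffeo : (⟨{0}ᶜ, isOpen_compl_singleton⟩ : TopologicalSpace.Opens E)
    ≃ₘ^∞⟮𝓘(ℝ, E), (𝓡 n).prod 𝓘(ℝ, ℝ)⟯ (Metric.sphere (0 : E) 1 × ℝ) where
  toFun x := (⟨‖x.1‖⁻¹ • x.1, by simp [norm_smul, norm_ne_zero_iff.2 x.2]⟩, Real.log ‖x.1‖)
  invFun p := ⟨Real.exp p.2 • p.1.1,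
    smul_ne_zero (Real.exp_ne_zero _) (ne_zero_of_mem_unit_sphere p.1)⟩
  left_inv x := by
    have hx : 0 < ‖x.1‖ := norm_pos_iff.2 x.2
    simp [Real.exp_log hx, smul_smul, hx.ne']
  right_inv p := by
    simp [norm_smul, smul_smul]
  contMDiff_toFun := by
    have hx (x : (⟨{0}ᶜ, isOpen_compl_singleton⟩ : TopologicalSpace.Opens E)) : x.1 ≠ 0 := x.2
    have hnorm : ContDiffOn ℝ ∞ (fun x : E => ‖x‖) {0}ᶜ := fun x hx =>
      (contDiffAt_norm ℝ hx).contDiffWithinAt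
    refine .prodMk (.codRestrict_sphere ?_ _) ?_
    · exact ((hnorm.inv fun x hx => norm_ne_zero_iff.2 hx).smul
        contDiffOn_id).contMDiffOn.comp_contMDiff contMDiff_subtype_val hx
    · exact (hnorm.log fun x hx => norm_ne_zero_iff.2 hx).contMDiffOn.comp_contMDiff
        contMDiff_subtype_val hx
  contMDiff_invFun := (ContMDiff.subtypeVal_comp_iff _ _).1 <|
    (Real.contDiff_exp.contMDiff.comp contMDiff_snd).smul
      (contMDiff_coe_sphere.comp contMDiff_fst)

end Polar

section SmoothMultipole

open Topology

variable {v : Fin 3 → (Fin 3 → ℝ)} {Q : QuadraticForm ℝ (Fin 3 → ℝ)} {d : ℕ}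

instance MultipoleSpace.instNonempty : Nonempty (MultipoleSpace d) :=
  ⟨.mk fun _ => ⟨1, one_ne_zero⟩⟩

theorem MultipoleSpace.exists_mem_chartDomain (hQ : Q.PosDef) (m : MultipoleSpace d) :
    ∃ v, IsOrthonormalFrame Q v ∧ m ∈ MultipoleSpace.chartDomain v d := by
  obtain ⟨L, rfl⟩ := m.exists_rep
  obtain ⟨v, hv, hL⟩ := exists_isOrthonormalFrame hQ L
  exact ⟨v, hv, L, rfl, hL⟩

theorem conicMapHomeo_symm_multipoleMap {m : MultipoleSpace d}
    (hm : m ∈ MultipoleSpace.chartDomain v d) :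
    (conicMapHomeo d).symm (multipoleMap v d m) = MultipoleSpace.chartCoord v d m := by
  rw [eqOn_multipoleMap_conicMap v d hm]
  exact (conicMapHomeo d).left_inv (MultipoleSpace.mapsTo_chartCoord v d hm)

theorem IsOrthonormalFrame.exists_multipoleMap_symm_eq (hv : IsOrthonormalFrame Q v)
    {e : OpenPartialHomeomorph (MultipoleSpace d) ((Fin d → ℂ) × ℝ)}
    (he : e ∈ MultipoleSpace.conicAtlas Q d) :
    ∃ T : ((Fin d → ℂ) × ℝ) →L[ℝ] (Fin d → ℂ) × ℝ,
      ∀ x ∈ e.target, multipoleMap v d (e.symm x) = T (conicMap d x) := by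
  obtain ⟨v', hv', hsource, hcoe⟩ := he
  obtain ⟨T, hT⟩ := hv'.exists_multipoleMap_eq_comp hv d
  refine ⟨T, fun x hx => ?_⟩
  have hx' := e.map_target hx
  rw [hT, eqOn_multipoleMap_conicMap v' d (hsource ▸ hx'), Function.comp_apply, ← hcoe hx',
    e.right_inv hx]

namespace IsOrthonormalFrame

variable [NeZero d] (hQ : Q.PosDef) (hv : IsOrthonormalFrame Q v)

include hQ hv

theorem exists_eq_conicMapHomeo_symm
    {e : OpenPartialHomeomorph (MultipoleSpace d) ((Fin d → ℂ) × ℝ)}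
    (he : e ∈ MultipoleSpace.conicAtlas Q d) :
    ∃ T : ((Fin d → ℂ) × ℝ) →L[ℝ] (Fin d → ℂ) × ℝ, ∀ m ∈ e.source,
      T (multipoleMap v d m) ∈ (conicMapHomeo d).target ∧
        e m = (conicMapHomeo d).symm (T (multipoleMap v d m)) := by
  obtain ⟨v', hv', hsource, hcoe⟩ := he
  obtain ⟨T, hT⟩ := hv.exists_multipoleMap_eq_comp hv' d
  refine ⟨T, fun m hm => ?_⟩
  have hm' : m ∈ MultipoleSpace.chartDomain v' d := hsource ▸ hm
  rw [← hT, conicMapHomeo_symm_multipoleMap hm']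
  exact ⟨(hv'.mem_chartDomain_iff hQ).1 hm', hcoe hm⟩

/-- The multipole map as a homeomorphism onto the complement of the origin. -/
def multipoleHomeo (d : ℕ) [NeZero d] :
    OpenPartialHomeomorph (MultipoleSpace d) ((Fin d → ℂ) × ℝ) :=
  (hv.isOpenEmbedding_multipoleMap hQ).toOpenPartialHomeomorph (multipoleMap v d)

theorem multipoleHomeo_target : (multipoleHomeo hQ hv d).target = {0}ᶜ := by
  rw [multipoleHomeo, IsOpenEmbedding.toOpenPartialHomeomorph_target, hv.range_multipoleMap]

/-- The chart of the multipole space given by an orthonormal frame. -/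
def multipoleChart (d : ℕ) [NeZero d] :
    OpenPartialHomeomorph (MultipoleSpace d) ((Fin d → ℂ) × ℝ) :=
  multipoleHomeo hQ hv d ≫ₕ (conicMapHomeo d).symm

theorem multipoleChart_source :
    (multipoleChart hQ hv d).source = MultipoleSpace.chartDomain v d := by
  ext m
  rw [hv.mem_chartDomain_iff hQ, multipoleChart, OpenPartialHomeomorph.trans_source]
  exact and_iff_right trivial

theorem multipoleChart_mem_conicAtlas :
    multipoleChart hQ hv d ∈ MultipoleSpace.conicAtlas Q d :=
  ⟨v, hv, multipoleChart_source hQ hv, fun _ hm =>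
    conicMapHomeo_symm_multipoleMap ((multipoleChart_source hQ hv).subset hm)⟩

end IsOrthonormalFrame

/-- The multipole space with the atlas defined by a positive definite form. -/
@[reducible]
def conicMultipoleChartedSpace (hQ : Q.PosDef) (d : ℕ) [NeZero d] :
    ChartedSpace ((Fin d → ℂ) × ℝ) (MultipoleSpace d) where
  atlas := MultipoleSpace.conicAtlas Q d
  chartAt m := (m.exists_mem_chartDomain hQ).choose_spec.1.multipoleChart hQ d
  mem_chart_source m := by
    rw [IsOrthonormalFrame.multipoleChart_source]
    exact (m.exists_mem_chartDomain hQ).choose_spec.2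
  chart_mem_atlas m := (m.exists_mem_chartDomain hQ).choose_spec.1.multipoleChart_mem_conicAtlas hQ

theorem IsOrthonormalFrame.contMDiffOn_multipoleMap_comp_symm (hv : IsOrthonormalFrame Q v)
    {e : OpenPartialHomeomorph (MultipoleSpace d) ((Fin d → ℂ) × ℝ)}
    (he : e ∈ MultipoleSpace.conicAtlas Q d) :
    ContMDiffOn 𝓘(ℝ, (Fin d → ℂ) × ℝ) 𝓘(ℝ, (Fin d → ℂ) × ℝ) ∞ (multipoleMap v d ∘ e.symm)
      e.target := by
  obtain ⟨T, hT⟩ := hv.exists_multipoleMap_symm_eq he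
  exact (T.contDiff.comp contDiff_conicMap).contDiffOn.contMDiffOn.congr hT

theorem IsOrthonormalFrame.contMDiffOn_comp_multipoleHomeo_symm [NeZero d] (hQ : Q.PosDef)
    (hv : IsOrthonormalFrame Q v)
    {e : OpenPartialHomeomorph (MultipoleSpace d) ((Fin d → ℂ) × ℝ)}
    (he : e ∈ MultipoleSpace.conicAtlas Q d) :
    ContMDiffOn 𝓘(ℝ, (Fin d → ℂ) × ℝ) 𝓘(ℝ, (Fin d → ℂ) × ℝ) ∞ (e ∘ (hv.multipoleHomeo hQ d).symm)
      ((hv.multipoleHomeo hQ d).target ∩ (hv.multipoleHomeo hQ d).symm ⁻¹' e.source) := by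
  obtain ⟨T, hT⟩ := hv.exists_eq_conicMapHomeo_symm hQ he
  have hright {h : (Fin d → ℂ) × ℝ} (hh : h ∈ (hv.multipoleHomeo hQ d).target) :
      multipoleMap v d ((hv.multipoleHomeo hQ d).symm h) = h :=
    (hv.multipoleHomeo hQ d).right_inv hh
  refine ContDiffOn.contMDiffOn <|
    (contDiffOn_conicMapHomeo_symm.comp T.contDiff.contDiffOn fun h hh => ?_).congr fun h hh => ?_
  · simpa only [hright hh.1] using (hT _ hh.2).1
  · simpa only [hright hh.1, Function.comp_apply] using (hT _ hh.2).2

/-- Linear coordinates on the target of the multipole map. -/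
def antipodalEquivEuclidean (d : ℕ) :
    ((Fin d → ℂ) × ℝ) ≃L[ℝ] EuclideanSpace ℝ (Fin (2 * d + 1)) :=
  .ofFinrankEq (by
    simp [Module.finrank_pi_fintype, Complex.finrank_real_complex, mul_comm])

theorem IsOrthonormalFrame.antipodalEquivEuclidean_symm_mem_target [NeZero d] (hQ : Q.PosDef)
    (hv : IsOrthonormalFrame Q v) (y : puncturedSpace (2 * d + 1)) :
    (antipodalEquivEuclidean d).symm y ∈ (hv.multipoleHomeo hQ d).target := by
  rw [multipoleHomeo_target, Set.mem_compl_singleton_iff, Ne, EmbeddingLike.map_eq_zero_iff]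
  exact y.2

section ChartedSpace

variable [ChartedSpace ((Fin d → ℂ) × ℝ) (MultipoleSpace d)]
  (hatlas : atlas ((Fin d → ℂ) × ℝ) (MultipoleSpace d) ⊆ MultipoleSpace.conicAtlas Q d)

include hatlas

namespace IsOrthonormalFrame

variable [NeZero d] (hQ : Q.PosDef) (hv : IsOrthonormalFrame Q v)

include hQ hv

theorem isManifold_multipoleSpace : IsManifold 𝓘(ℝ, (Fin d → ℂ) × ℝ) ∞ (MultipoleSpace d) :=
  isManifold_of_forall_contMDiffOn (f := hv.multipoleHomeo hQ d) rfl
    (fun _ he => hv.contMDiffOn_multipoleMap_comp_symm (hatlas he))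
    fun _ he => hv.contMDiffOn_comp_multipoleHomeo_symm hQ (hatlas he)

theorem contMDiff_multipoleMap :
    ContMDiff 𝓘(ℝ, (Fin d → ℂ) × ℝ) 𝓘(ℝ, (Fin d → ℂ) × ℝ) ∞ (multipoleMap v d) :=
  have := hv.isManifold_multipoleSpace hatlas hQ
  contMDiff_of_forall_contMDiffOn_comp_symm fun _ he =>
    hv.contMDiffOn_multipoleMap_comp_symm (hatlas he)

theorem contMDiffOn_multipoleHomeo_symm :
    ContMDiffOn 𝓘(ℝ, (Fin d → ℂ) × ℝ) 𝓘(ℝ, (Fin d → ℂ) × ℝ) ∞ (hv.multipoleHomeo hQ d).symm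
      (hv.multipoleHomeo hQ d).target :=
  contMDiffOn_of_forall_contMDiffOn_chart_comp (hv.multipoleHomeo hQ d).continuousOn_symm
    fun _ he => hv.contMDiffOn_comp_multipoleHomeo_symm hQ (hatlas he)

/-- The diffeomorphism from the multipole space to a punctured Euclidean space given by the
multipole map and a choice of linear coordinates. -/
def multipoleDiffeo :
    MultipoleSpace d ≃ₘ^∞⟮𝓘(ℝ, (Fin d → ℂ) × ℝ), 𝓘(ℝ, EuclideanSpace ℝ (Fin (2 * d + 1)))⟯
      puncturedSpace (2 * d + 1) where
  toFun m := ⟨antipodalEquivEuclidean d (multipoleMap v d m),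
    (map_ne_zero_iff _ (antipodalEquivEuclidean d).injective).2 (hv.multipoleMap_ne_zero m)⟩
  invFun y := (hv.multipoleHomeo hQ d).symm ((antipodalEquivEuclidean d).symm y)
  left_inv m := by
    simp only [ContinuousLinearEquiv.symm_apply_apply]
    exact (hv.multipoleHomeo hQ d).left_inv trivial
  right_inv y := Subtype.ext <| by
    change antipodalEquivEuclidean d (hv.multipoleHomeo hQ d _) = _
    rw [(hv.multipoleHomeo hQ d).right_inv (antipodalEquivEuclidean_symm_mem_target hQ hv y),
      ContinuousLinearEquiv.apply_symm_apply]
  contMDiff_toFun := (ContMDiff.subtypeVal_comp_iff _ _).1 <|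
    (antipodalEquivEuclidean d).contDiff.contMDiff.comp (hv.contMDiff_multipoleMap hatlas hQ)
  contMDiff_invFun := (hv.contMDiffOn_multipoleHomeo_symm hatlas hQ).comp_contMDiff
    ((antipodalEquivEuclidean d).symm.contDiff.contMDiff.comp contMDiff_subtype_val)
    (antipodalEquivEuclidean_symm_mem_target hQ hv)

end IsOrthonormalFrame

end ChartedSpace

end SmoothMultipole

/-! ### The symmetric power of the projective plane -/

section SymmetricPower

open Topology

variable {v : Fin 3 → (Fin 3 → ℝ)} {Q : QuadraticForm ℝ (Fin 3 → ℝ)} {d : ℕ}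

/-- The point of `ℝP²` given by a nonzero linear form. -/
def projForm (L : LinForm) : RealProj 2 := Projectivization.mk ℝ L.1 L.2

theorem projForm_eq_iff {L M : LinForm} :
    projForm L = projForm M ↔ ∃ t, LinForm.scale t M = L := by
  simp only [projForm, Projectivization.mk_eq_mk_iff, Subtype.ext_iff]
  rfl

theorem projForm_scale (t : ℝˣ) (L : LinForm) : projForm (LinForm.scale t L) = projForm L :=
  projForm_eq_iff.2 ⟨t, rfl⟩

theorem frameValue_rep_projForm_ne_zero_iff (v : Fin 3 → (Fin 3 → ℝ)) (i : Fin 3) (L : LinForm) :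
    frameValue v i (projForm L).rep ≠ 0 ↔ frameValue v i L.1 ≠ 0 := by
  obtain ⟨t, ht⟩ := Projectivization.exists_smul_eq_mk_rep ℝ L.1 L.2
  rw [projForm, ← ht, Units.smul_def, frameValue_smul]
  simp

/-- The projection of the multipole space onto its quotient by the action of `ℝ^*`. -/
def toSymPower (d : ℕ) : MultipoleSpace d → SymPower (RealProj 2) d :=
  Quotient.lift (fun L => Quotient.mk (symPowerSetoid _ d) fun j => projForm (L j)) (by
    rintro L M ⟨σ, c, -, h⟩
    refine Quotient.sound ⟨σ, funext fun j => ?_⟩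
    rw [h, projForm_scale]
    rfl)

theorem toSymPower_mk_eq_iff {L M : Fin d → LinForm} :
    toSymPower d (.mk L) = toSymPower d (.mk M) ↔
      ∃ σ : Equiv.Perm (Fin d), ∀ j, projForm (M j) = projForm (L (σ j)) :=
  Quotient.eq.trans <| exists_congr fun _ => funext_iff

theorem isQuotientMap_toSymPower : IsQuotientMap (toSymPower d) :=
  .of_comp_isQuotientMap MultipoleSpace.isQuotientMap_mk <|
    (isQuotientMap_quot_mk (r := (symPowerSetoid (RealProj 2) d).r)).comp
      (IsOpenQuotientMap.piMap fun _ : Fin d =>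
        isOpenQuotientMap_projectivization_mk (Fin 3 → ℝ)).isQuotientMap

theorem exists_multipoleMap_eq_smul_of_toSymPower_eq (v : Fin 3 → (Fin 3 → ℝ))
    {m n : MultipoleSpace d} (h : toSymPower d m = toSymPower d n) :
    ∃ t : ℝˣ, multipoleMap v d n = t • multipoleMap v d m := by
  obtain ⟨L, rfl⟩ := m.exists_rep
  obtain ⟨M, rfl⟩ := n.exists_rep
  obtain ⟨σ, hσ⟩ := toSymPower_mk_eq_iff.1 h
  choose t ht using fun j => projForm_eq_iff.1 (hσ j)
  have hperm : multipoleMap v d (.mk (L ∘ σ)) = multipoleMap v d (.mk L) := by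
    rw [multipoleMap_mk, multipoleMap_mk, multipolePoly_comp_perm]
  refine ⟨∏ j, t j, ?_⟩
  rw [← hperm, Units.smul_def, ← multipoleMap_mk_scale]
  exact congrArg (multipoleMap v d <| .mk ·) (funext ht).symm

theorem IsOrthonormalFrame.toSymPower_eq_iff [NeZero d] (hQ : Q.PosDef)
    (hv : IsOrthonormalFrame Q v) {m n : MultipoleSpace d} :
    toSymPower d m = toSymPower d n ↔
      ∃ t : ℝˣ, multipoleMap v d n = t • multipoleMap v d m := by
  refine ⟨exists_multipoleMap_eq_smul_of_toSymPower_eq v, ?_⟩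
  rintro ⟨t, ht⟩
  obtain ⟨L, rfl⟩ := m.exists_rep
  have hscale : n = .mk fun j => LinForm.scale ((Pi.mulSingle 0 t : Fin d → ℝˣ) j) (L j) :=
    hv.multipoleMap_injective hQ <| by
      rw [ht, multipoleMap_mk_scale, Fintype.prod_pi_mulSingle', Units.smul_def]
  rw [hscale]
  exact toSymPower_mk_eq_iff.2 ⟨1, fun j => projForm_scale _ _⟩

theorem toSymPower_mem_chartDomain_iff {m : MultipoleSpace d} :
    toSymPower d m ∈ SymPower.chartDomain v d ↔ m ∈ MultipoleSpace.chartDomain v d := by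
  constructor
  · rintro ⟨p, hp, hp2⟩
    obtain ⟨L, rfl⟩ := m.exists_rep
    obtain ⟨σ, rfl⟩ := Quotient.exact hp
    refine ⟨L, rfl, fun j => ?_⟩
    simpa [frameValue_rep_projForm_ne_zero_iff] using hp2 (σ⁻¹ j)
  · rintro ⟨L, rfl, hL⟩
    exact ⟨_, rfl, fun j => (frameValue_rep_projForm_ne_zero_iff v 2 (L j)).2 (hL j)⟩

theorem toSymPower_preimage_chartDomain (v : Fin 3 → (Fin 3 → ℝ)) (d : ℕ) :
    toSymPower d ⁻¹' SymPower.chartDomain v d = MultipoleSpace.chartDomain v d :=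
  Set.ext fun _ => toSymPower_mem_chartDomain_iff

theorem chartCoord_toSymPower (v : Fin 3 → (Fin 3 → ℝ)) (m : MultipoleSpace d) :
    SymPower.chartCoord v d (toSymPower d m) = (MultipoleSpace.chartCoord v d m).1 := by
  obtain ⟨L, rfl⟩ := m.exists_rep
  rfl

theorem SymPower.mapsTo_chartCoord (v : Fin 3 → (Fin 3 → ℝ)) (d : ℕ) :
    Set.MapsTo (chartCoord v d) (chartDomain v d) (discRootSet d) := by
  intro x hx
  obtain ⟨m, rfl⟩ := isQuotientMap_toSymPower.surjective x
  rw [chartCoord_toSymPower]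
  exact (MultipoleSpace.mapsTo_chartCoord v d (toSymPower_mem_chartDomain_iff.1 hx)).1

theorem SymPower.exists_mem_chartDomain (hQ : Q.PosDef) (x : SymPower (RealProj 2) d) :
    ∃ v, IsOrthonormalFrame Q v ∧ x ∈ chartDomain v d := by
  obtain ⟨m, rfl⟩ := isQuotientMap_toSymPower.surjective x
  obtain ⟨v, hv, hm⟩ := m.exists_mem_chartDomain hQ
  exact ⟨v, hv, toSymPower_mem_chartDomain_iff.2 hm⟩

theorem conicMap_ne_zero {x : (Fin d → ℂ) × ℝ} (hx : x ∈ (conicMapHomeo d).source) :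
    conicMap d x ≠ 0 := by
  obtain ⟨a, t⟩ := x
  intro h0
  have hx' : (a, (2 : ℝ) * t) ∈ (conicMapHomeo d).source := ⟨hx.1, mul_ne_zero two_ne_zero hx.2⟩
  have heq : (a, (2 : ℝ) * t) = (a, t) := (conicMapHomeo d).injOn hx' hx <| by
    simp only [coe_conicMapHomeo, conicMap_smul, h0, smul_zero]
  have ht : t = 0 := by linarith [congrArg Prod.snd heq]
  exact hx.2 ht

namespace IsOrthonormalFrame

variable [NeZero d] (hQ : Q.PosDef) (hv : IsOrthonormalFrame Q v)

include hQ hv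

theorem injOn_symPower_chartCoord :
    Set.InjOn (SymPower.chartCoord v d) (SymPower.chartDomain v d) := by
  intro x hx y hy hxy
  obtain ⟨m, rfl⟩ := isQuotientMap_toSymPower.surjective x
  obtain ⟨n, rfl⟩ := isQuotientMap_toSymPower.surjective y
  rw [chartCoord_toSymPower, chartCoord_toSymPower] at hxy
  have hm := toSymPower_mem_chartDomain_iff.1 hx
  have hn := toSymPower_mem_chartDomain_iff.1 hy
  have hm2 : (MultipoleSpace.chartCoord v d m).2 ≠ 0 :=
    (MultipoleSpace.mapsTo_chartCoord v d hm).2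
  have hn2 : (MultipoleSpace.chartCoord v d n).2 ≠ 0 :=
    (MultipoleSpace.mapsTo_chartCoord v d hn).2
  refine (hv.toSymPower_eq_iff hQ).2 ⟨Units.mk0 _ (div_ne_zero hn2 hm2), ?_⟩
  rw [eqOn_multipoleMap_conicMap v d hm, eqOn_multipoleMap_conicMap v d hn, Units.smul_mk0,
    Function.comp_apply, Function.comp_apply, ← Prod.mk.eta (p := MultipoleSpace.chartCoord v d m),
    ← conicMap_smul, div_mul_cancel₀ _ hm2, hxy]

theorem multipoleChart_target : (multipoleChart hQ hv d).target = discRootSet d ×ˢ {0}ᶜ := by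
  rw [multipoleChart, OpenPartialHomeomorph.trans_target, multipoleHomeo_target]
  exact Set.inter_eq_left.2 fun x hx => conicMap_ne_zero hx

theorem chartCoord_multipoleChart_symm {x : (Fin d → ℂ) × ℝ}
    (hx : x ∈ (multipoleChart hQ hv d).target) :
    (multipoleChart hQ hv d).symm x ∈ MultipoleSpace.chartDomain v d ∧
      MultipoleSpace.chartCoord v d ((multipoleChart hQ hv d).symm x) = x := by
  have hmem := (multipoleChart_source hQ hv).subset ((multipoleChart hQ hv d).map_target hx)
  exact ⟨hmem, (conicMapHomeo_symm_multipoleMap hmem).symm.trans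
    ((multipoleChart hQ hv d).right_inv hx)⟩

theorem mk_one_mem_multipoleChart_target {a : Fin d → ℂ} (ha : a ∈ discRootSet d) :
    (a, (1 : ℝ)) ∈ (multipoleChart hQ hv d).target :=
  (multipoleChart_target hQ hv).ge ⟨ha, one_ne_zero⟩

theorem isOpen_symPower_chartDomain : IsOpen (SymPower.chartDomain v d) := by
  rw [← isQuotientMap_toSymPower.isOpen_preimage, toSymPower_preimage_chartDomain,
    ← multipoleChart_source hQ hv]
  exact (multipoleChart hQ hv d).open_source

/-- The chart of the symmetric power given by an orthonormal frame. Its inverse lifts to the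
multipoles whose coordinate along the fibre is `1`. -/
def symPowerChart (d : ℕ) [NeZero d] :
    OpenPartialHomeomorph (SymPower (RealProj 2) d) (Fin d → ℂ) where
  toFun := SymPower.chartCoord v d
  invFun a := toSymPower d ((multipoleChart hQ hv d).symm (a, 1))
  source := SymPower.chartDomain v d
  target := discRootSet d
  map_source' _ hx := SymPower.mapsTo_chartCoord v d hx
  map_target' a ha := toSymPower_mem_chartDomain_iff.2
    (chartCoord_multipoleChart_symm hQ hv (mk_one_mem_multipoleChart_target hQ hv ha)).1
  left_inv' x hx := by
    have hsymm := chartCoord_multipoleChart_symm hQ hv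
      (mk_one_mem_multipoleChart_target hQ hv (SymPower.mapsTo_chartCoord v d hx))
    refine injOn_symPower_chartCoord hQ hv (toSymPower_mem_chartDomain_iff.2 hsymm.1) hx ?_
    rw [chartCoord_toSymPower, hsymm.2]
  right_inv' a ha := by
    rw [chartCoord_toSymPower,
      (chartCoord_multipoleChart_symm hQ hv (mk_one_mem_multipoleChart_target hQ hv ha)).2]
  open_source := isOpen_symPower_chartDomain hQ hv
  open_target := isOpen_discRootSet
  continuousOn_toFun := by
    rw [isQuotientMap_toSymPower.continuousOn_isOpen_iff (isOpen_symPower_chartDomain hQ hv),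
      toSymPower_preimage_chartDomain]
    have hfst := continuous_fst.comp_continuousOn (multipoleChart hQ hv d).continuousOn
    rw [multipoleChart_source] at hfst
    refine hfst.congr fun m hm => ?_
    rw [Function.comp_apply, chartCoord_toSymPower, ← conicMapHomeo_symm_multipoleMap hm]
    rfl
  continuousOn_invFun :=
    isQuotientMap_toSymPower.continuous.comp_continuousOn <|
      (multipoleChart hQ hv d).continuousOn_symm.comp
        (continuous_id.prodMk continuous_const).continuousOn
        fun _ ha => mk_one_mem_multipoleChart_target hQ hv ha

theorem exists_toSymPower_eq_symm {e : OpenPartialHomeomorph (SymPower (RealProj 2) d) (Fin d → ℂ)}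
    (hsource : e.source = SymPower.chartDomain v d)
    (hcoe : Set.EqOn e (SymPower.chartCoord v d) e.source) {a : Fin d → ℂ} (ha : a ∈ e.target) :
    ∃ m, toSymPower d m = e.symm a ∧ multipoleMap v d m = conicMap d (a, 1) := by
  have hmem : e.symm a ∈ SymPower.chartDomain v d := hsource ▸ e.map_target ha
  have hcoord : SymPower.chartCoord v d (e.symm a) = a := by
    rw [← hcoe (e.map_target ha), e.right_inv ha]
  have hdisc : a ∈ discRootSet d := hcoord ▸ SymPower.mapsTo_chartCoord v d hmem
  obtain ⟨hm, hmcoord⟩ :=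
    chartCoord_multipoleChart_symm hQ hv (mk_one_mem_multipoleChart_target hQ hv hdisc)
  refine ⟨(multipoleChart hQ hv d).symm (a, 1), ?_, ?_⟩
  · refine injOn_symPower_chartCoord hQ hv (toSymPower_mem_chartDomain_iff.2 hm) hmem ?_
    rw [chartCoord_toSymPower, hmcoord, hcoord]
  · rw [eqOn_multipoleMap_conicMap v d hm, Function.comp_apply, hmcoord]

end IsOrthonormalFrame

/-- The symmetric power of `ℝP²` with the atlas defined by a positive definite form. -/
@[reducible]
def conicSymPowerChartedSpace (hQ : Q.PosDef) (d : ℕ) [NeZero d] :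
    ChartedSpace (Fin d → ℂ) (SymPower (RealProj 2) d) where
  atlas := SymPower.conicAtlas Q d
  chartAt x := (x.exists_mem_chartDomain hQ).choose_spec.1.symPowerChart hQ d
  mem_chart_source x := (x.exists_mem_chartDomain hQ).choose_spec.2
  chart_mem_atlas x := ⟨_, (x.exists_mem_chartDomain hQ).choose_spec.1, rfl, fun _ _ => rfl⟩

end SymmetricPower

/-! ### The symmetric power as a projective space -/

section Quotients

open Topology

variable {X Y Z : Type*} [TopologicalSpace X] [TopologicalSpace Y] [TopologicalSpace Z]
  {p : X → Y} {q : X → Z} (hp : IsQuotientMap p) (hq : IsQuotientMap q)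
  (h : ∀ x y, p x = p y ↔ q x = q y)

/-- The homeomorphism between two quotients of a space by the same equivalence relation. -/
def homeomorphOfIsQuotientMap : Y ≃ₜ Z where
  toFun y := q (Function.surjInv hp.surjective y)
  invFun z := p (Function.surjInv hq.surjective z)
  left_inv y := by
    obtain ⟨x, rfl⟩ := hp.surjective y
    exact (h _ _).2 ((Function.surjInv_eq _ _).trans ((h _ _).1 (Function.surjInv_eq _ _)))
  right_inv z := by
    obtain ⟨x, rfl⟩ := hq.surjective z
    exact (h _ _).1 ((Function.surjInv_eq _ _).trans ((h _ _).2 (Function.surjInv_eq _ _)))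
  continuous_toFun := hp.continuous_iff.2 <|
    hq.continuous.congr fun _ => ((h _ _).1 (Function.surjInv_eq _ _)).symm
  continuous_invFun := hq.continuous_iff.2 <|
    hp.continuous.congr fun _ => ((h _ _).2 (Function.surjInv_eq _ _)).symm

theorem homeomorphOfIsQuotientMap_apply (x : X) : homeomorphOfIsQuotientMap hp hq h (p x) = q x :=
  (h _ _).1 (Function.surjInv_eq _ _)

end Quotients

section ProjectiveSpace

open Topology

variable {v : Fin 3 → (Fin 3 → ℝ)} {Q : QuadraticForm ℝ (Fin 3 → ℝ)} {d : ℕ}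

/-- Linear coordinates on the target of the multipole map, in the space whose projectivization is
`RealProj (2 * d)`. -/
def antipodalEquivPi (d : ℕ) : ((Fin d → ℂ) × ℝ) ≃L[ℝ] (Fin (2 * d + 1) → ℝ) :=
  .ofFinrankEq (by
    simp [Module.finrank_pi_fintype, Complex.finrank_real_complex, mul_comm])

namespace IsOrthonormalFrame

section

variable (hv : IsOrthonormalFrame Q v)

include hv

theorem antipodalEquivPi_multipoleMap_ne_zero (m : MultipoleSpace d) :
    antipodalEquivPi d (multipoleMap v d m) ≠ 0 :=
  (map_ne_zero_iff _ (antipodalEquivPi d).injective).2 (hv.multipoleMap_ne_zero m)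

/-- The class of the multipole map in projective space. -/
def multipoleProj (m : MultipoleSpace d) : RealProj (2 * d) :=
  Projectivization.mk ℝ _ (hv.antipodalEquivPi_multipoleMap_ne_zero m)

theorem continuous_multipoleProj : Continuous (multipoleProj hv (d := d)) :=
  (isOpenQuotientMap_projectivization_mk _).continuous.comp
    (((antipodalEquivPi d).continuous.comp (continuous_multipoleMap v d)).subtype_mk
      hv.antipodalEquivPi_multipoleMap_ne_zero)

end

variable [NeZero d] (hQ : Q.PosDef) (hv : IsOrthonormalFrame Q v)

include hQ hv

theorem toSymPower_eq_iff_multipoleProj_eq (m n : MultipoleSpace d) :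
    toSymPower d m = toSymPower d n ↔ multipoleProj hv m = multipoleProj hv n := by
  rw [eq_comm, toSymPower_eq_iff hQ hv, multipoleProj, multipoleProj,
    Projectivization.mk_eq_mk_iff]
  refine exists_congr fun t => ?_
  rw [Units.smul_def, Units.smul_def, ← map_smul, (antipodalEquivPi d).injective.eq_iff, eq_comm]

theorem antipodalEquivPi_symm_mem_target {x : Fin (2 * d + 1) → ℝ} (hx : x ≠ 0) :
    (antipodalEquivPi d).symm x ∈ (multipoleHomeo hQ hv d).target := by
  rw [multipoleHomeo_target]
  exact (map_ne_zero_iff _ (antipodalEquivPi d).symm.injective).2 hx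

/-- The multipole with given nonzero homogeneous coordinates. -/
def multipoleOfCoords (x : {x : Fin (2 * d + 1) → ℝ // x ≠ 0}) : MultipoleSpace d :=
  (multipoleHomeo hQ hv d).symm ((antipodalEquivPi d).symm x.1)

theorem multipoleMap_multipoleOfCoords (x : {x : Fin (2 * d + 1) → ℝ // x ≠ 0}) :
    multipoleMap v d (multipoleOfCoords hQ hv x) = (antipodalEquivPi d).symm x.1 :=
  (multipoleHomeo hQ hv d).right_inv (antipodalEquivPi_symm_mem_target hQ hv x.2)

theorem multipoleProj_multipoleOfCoords (x : {x : Fin (2 * d + 1) → ℝ // x ≠ 0}) :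
    multipoleProj hv (multipoleOfCoords hQ hv x) = Projectivization.mk ℝ x.1 x.2 := by
  simp only [multipoleProj, multipoleMap_multipoleOfCoords,
    ContinuousLinearEquiv.apply_symm_apply]

theorem continuous_multipoleOfCoords : Continuous (multipoleOfCoords hQ hv (d := d)) :=
  (multipoleHomeo hQ hv d).continuousOn_symm.comp_continuous
    ((antipodalEquivPi d).symm.continuous.comp continuous_subtype_val)
    fun x => antipodalEquivPi_symm_mem_target hQ hv x.2

theorem isQuotientMap_multipoleProj : IsQuotientMap (multipoleProj hv (d := d)) :=
  .of_comp (continuous_multipoleOfCoords hQ hv) hv.continuous_multipoleProj <| by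
    rw [show multipoleProj hv ∘ multipoleOfCoords hQ hv = _ from
      funext (multipoleProj_multipoleOfCoords hQ hv)]
    exact (isOpenQuotientMap_projectivization_mk _).isQuotientMap

/-- The symmetric power of `ℝP²` and projective space as the same quotient of the multipole
space. -/
def symPowerHomeo (d : ℕ) [NeZero d] : SymPower (RealProj 2) d ≃ₜ RealProj (2 * d) :=
  homeomorphOfIsQuotientMap isQuotientMap_toSymPower (isQuotientMap_multipoleProj hQ hv)
    (toSymPower_eq_iff_multipoleProj_eq hQ hv)

theorem symPowerHomeo_toSymPower (m : MultipoleSpace d) :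
    symPowerHomeo hQ hv d (toSymPower d m) = multipoleProj hv m :=
  homeomorphOfIsQuotientMap_apply _ _ _ m

theorem symPowerHomeo_symm_mk {x : Fin (2 * d + 1) → ℝ} (hx : x ≠ 0) :
    (symPowerHomeo hQ hv d).symm (Projectivization.mk ℝ x hx) =
      toSymPower d (multipoleOfCoords hQ hv ⟨x, hx⟩) := by
  rw [Homeomorph.symm_apply_eq, symPowerHomeo_toSymPower, multipoleProj_multipoleOfCoords]

variable [ChartedSpace (Fin (2 * d) → ℝ) (RealProj (2 * d))]
  (hproj : atlas (Fin (2 * d) → ℝ) (RealProj (2 * d)) ⊆ RealProj.stdAtlas (2 * d))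

include hproj

theorem contMDiffOn_symPowerHomeo_comp_symm
    {e : OpenPartialHomeomorph (SymPower (RealProj 2) d) (Fin d → ℂ)}
    (he : e ∈ SymPower.conicAtlas Q d) :
    ContMDiffOn 𝓘(ℝ, Fin d → ℂ) 𝓘(ℝ, Fin (2 * d) → ℝ) ∞ (symPowerHomeo hQ hv d ∘ e.symm)
      e.target := by
  obtain ⟨v', hv', hsource, hcoe⟩ := he
  obtain ⟨T, hT⟩ := hv'.exists_multipoleMap_eq_comp hv d
  have hcoords : ContDiff ℝ ∞ fun a => antipodalEquivPi d (T (conicMap d (a, 1))) :=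
    (antipodalEquivPi d).contDiff.comp
      (T.contDiff.comp (contDiff_conicMap.comp (contDiff_prodMk_left (1 : ℝ))))
  refine RealProj.contMDiffOn_of_eq_mk hproj hcoords.contMDiff.contMDiffOn fun a ha => ?_
  obtain ⟨m, hm, hma⟩ := hv'.exists_toSymPower_eq_symm hQ hsource hcoe ha
  rw [← hma, ← hT, Function.comp_apply, ← hm, symPowerHomeo_toSymPower]
  exact ⟨hv.antipodalEquivPi_multipoleMap_ne_zero m, rfl⟩

theorem contMDiffOn_comp_symPowerHomeo_symm
    {e : OpenPartialHomeomorph (SymPower (RealProj 2) d) (Fin d → ℂ)}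
    (he : e ∈ SymPower.conicAtlas Q d) :
    ContMDiffOn 𝓘(ℝ, Fin (2 * d) → ℝ) 𝓘(ℝ, Fin d → ℂ) ∞ (e ∘ (symPowerHomeo hQ hv d).symm)
      ((symPowerHomeo hQ hv d).symm ⁻¹' e.source) := by
  obtain ⟨v', hv', hsource, hcoe⟩ := he
  obtain ⟨T, hT⟩ := hv.exists_multipoleMap_eq_comp hv' d
  have hcoords : ContDiff ℝ ∞ fun x => T ((antipodalEquivPi d).symm x) :=
    T.contDiff.comp (antipodalEquivPi d).symm.contDiff
  have hroots : ContDiffOn ℝ ∞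
      (fun x => ((conicMapHomeo d).symm (T ((antipodalEquivPi d).symm x))).1)
      {x | T ((antipodalEquivPi d).symm x) ∈ (conicMapHomeo d).target} :=
    contDiff_fst.comp_contDiffOn
      (contDiffOn_conicMapHomeo_symm.comp hcoords.contDiffOn fun _ hx => hx)
  refine RealProj.contMDiffOn_of_comp_mk hproj hroots.contMDiffOn fun x hx hxe => ?_
  have hmap : T ((antipodalEquivPi d).symm x) =
      multipoleMap v' d (multipoleOfCoords hQ hv ⟨x, hx⟩) := by
    rw [hT, multipoleMap_multipoleOfCoords]
  rw [Set.mem_preimage, symPowerHomeo_symm_mk] at hxe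
  have hmem : multipoleOfCoords hQ hv ⟨x, hx⟩ ∈ MultipoleSpace.chartDomain v' d :=
    toSymPower_mem_chartDomain_iff.1 (hsource ▸ hxe)
  rw [Set.mem_ofPred_eq, hmap, Function.comp_apply, symPowerHomeo_symm_mk, hcoe hxe,
    chartCoord_toSymPower, conicMapHomeo_symm_multipoleMap hmem]
  exact ⟨(hv'.mem_chartDomain_iff hQ).1 hmem, rfl⟩

variable [ChartedSpace (Fin d → ℂ) (SymPower (RealProj 2) d)]
  (hatlas : atlas (Fin d → ℂ) (SymPower (RealProj 2) d) ⊆ SymPower.conicAtlas Q d)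

include hatlas

theorem isManifold_symPower : IsManifold 𝓘(ℝ, Fin d → ℂ) ∞ (SymPower (RealProj 2) d) :=
  isManifold_of_forall_contMDiffOn (f := (symPowerHomeo hQ hv d).toOpenPartialHomeomorph) rfl
    (fun _ he => contMDiffOn_symPowerHomeo_comp_symm hQ hv hproj (hatlas he))
    fun _ he => (contMDiffOn_comp_symPowerHomeo_symm hQ hv hproj (hatlas he)).mono
      Set.inter_subset_right

/-- The diffeomorphism from the symmetric power of `ℝP²` to projective space. -/
def symPowerDiffeo : SymPower (RealProj 2) d ≃ₘ^∞⟮𝓘(ℝ, Fin d → ℂ), 𝓘(ℝ, Fin (2 * d) → ℝ)⟯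
    RealProj (2 * d) where
  toEquiv := (symPowerHomeo hQ hv d).toEquiv
  contMDiff_toFun :=
    have := isManifold_symPower hQ hv hproj hatlas
    contMDiff_of_forall_contMDiffOn_comp_symm fun _ he =>
      contMDiffOn_symPowerHomeo_comp_symm hQ hv hproj (hatlas he)
  contMDiff_invFun := contMDiffOn_univ.1 <|
    contMDiffOn_of_forall_contMDiffOn_chart_comp
      (symPowerHomeo hQ hv d).symm.continuous.continuousOn fun _ he =>
        (contMDiffOn_comp_symPowerHomeo_symm hQ hv hproj (hatlas he)).mono Set.inter_subset_right

end IsOrthonormalFrame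

end ProjectiveSpace

end

theorem corollary15 (Q : QuadraticForm ℝ (Fin 3 → ℝ)) (hQ : Q.PosDef) (d : ℕ) (hd : 1 ≤ d) :
    (∃ _ : ChartedSpace ((Fin d → ℂ) × ℝ) (MultipoleSpace d),
      atlas ((Fin d → ℂ) × ℝ) (MultipoleSpace d) = MultipoleSpace.conicAtlas Q d ∧
      IsManifold 𝓘(ℝ, (Fin d → ℂ) × ℝ) ∞ (MultipoleSpace d) ∧
      Nonempty (MultipoleSpace d
        ≃ₘ^∞⟮𝓘(ℝ, (Fin d → ℂ) × ℝ), 𝓘(ℝ, EuclideanSpace ℝ (Fin (2 * d + 1)))⟯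
        puncturedSpace (2 * d + 1)) ∧
      Nonempty (MultipoleSpace d
        ≃ₘ^∞⟮𝓘(ℝ, (Fin d → ℂ) × ℝ), (𝓡 (2 * d)).prod 𝓘(ℝ, ℝ)⟯
        (Metric.sphere (0 : EuclideanSpace ℝ (Fin (2 * d + 1))) 1 × ℝ))) ∧
    Nonempty (ConedMultipoleSpace d ≃ₜ EuclideanSpace ℝ (Fin (2 * d + 1))) ∧
    (∃ (_ : ChartedSpace (Fin d → ℂ) (SymPower (RealProj 2) d))
      (_ : ChartedSpace (Fin (2 * d) → ℝ) (RealProj (2 * d))),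
      atlas (Fin d → ℂ) (SymPower (RealProj 2) d) = SymPower.conicAtlas Q d ∧
      atlas (Fin (2 * d) → ℝ) (RealProj (2 * d)) = RealProj.stdAtlas (2 * d) ∧
      IsManifold 𝓘(ℝ, Fin d → ℂ) ∞ (SymPower (RealProj 2) d) ∧
      IsManifold 𝓘(ℝ, Fin (2 * d) → ℝ) ∞ (RealProj (2 * d)) ∧
      Nonempty (SymPower (RealProj 2) d
        ≃ₘ^∞⟮𝓘(ℝ, Fin d → ℂ), 𝓘(ℝ, Fin (2 * d) → ℝ)⟯ RealProj (2 * d))) := by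
  have : NeZero d := ⟨by omega⟩
  have := Fact.mk (finrank_euclideanSpace_fin (𝕜 := ℝ) (n := 2 * d + 1))
  let _ := conicMultipoleChartedSpace hQ d
  let _ := conicSymPowerChartedSpace hQ d
  let _ := RealProj.stdChartedSpace (2 * d)
  obtain ⟨v, hv, -⟩ := exists_isOrthonormalFrame hQ (Fin.elim0 : Fin 0 → LinForm)
  have φ := hv.multipoleDiffeo (d := d) Set.Subset.rfl hQ
  exact ⟨⟨_, rfl, hv.isManifold_multipoleSpace Set.Subset.rfl hQ, ⟨φ⟩, ⟨φ.trans polarDiffeo⟩⟩,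
    ⟨(hv.isHomeomorph_conedMap hQ).homeomorph.trans (antipodalEquivEuclidean d).toHomeomorph⟩,
    _, _, rfl, rfl, hv.isManifold_symPower hQ Set.Subset.rfl Set.Subset.rfl,
    RealProj.isManifold_of_atlas_subset Set.Subset.rfl,
    ⟨hv.symPowerDiffeo hQ Set.Subset.rfl Set.Subset.rfl⟩⟩
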